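/- Let $G=\mathbb{Z}^3*\mathbb{Z}=\langle a,b,c,d\mid [a,b]=[b,c]=[a,c]=1\rangle$ be the right-angled Artin group of the disjoint union of a triangle and a point, and let $Y$ be the universal covering of its Salvetti complex (the ``tree of $3$-dimensional flats''), a $\mathrm{CAT}(0)$ cube complex whose $1$-skeleton is the Cayley graph of $G$; identify the vertices of $Y$ with the elements of $G$. Let $\partial_M Y$ be the Morse boundary, i.e. the set of classes of Morse quasi-geodesic rays up to finite Hausdorff distance. For a vertex $o$ and a hyperplane $k$ let $\#\mathcal{W}(o,k)$ be the number of hyperplanes separating $o$ from $k$. For $\xi,\eta\in\partial_M Y$ let $\mathcal{W}(\xi,\eta)$ be the set of hyperplanes crossed by exactly one of the geodesic ($\mathrm{CAT}(0)$) representatives of $\xi$ and $\eta$ based at $o$, and put $$[\xi|\eta]_o=\inf\{\#\mathcal{W}(o,k)\mid k\in\mathcal{W}(\xi,\eta)\},\qquad (\xi|\eta)_o=\#\{\text{hyperplanes separating } o \text{ from } \{\xi,\eta\}\}.$$ With $f_k(\xi)=e^{-\#\mathcal{W}(o,k)}$ if the geodesic representative of $\xi$ based at $o$ crosses $k$ and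 $f_k(\xi)=0$ otherwise, let $d_o(\xi,\eta)=\sup_k|f_k(\xi)-f_k(\eta)|$. Then $d_o=e^{-[\cdot|\cdot]_o}$ (with $e^{-\infty}=0$). Define $$cr_o(w,x,y,z)=[w|x]_o+[y|z]_o-[w|y]_o-[x|z]_o,\qquad [w,x,y,z]_o=(w|x)_o+(y|z)_o-(w|y)_o-(x|z)_o,$$ the second being the Beyrer--Fioravanti--Medici cross ratio, computed at $o$. Fix any vertex $o$. The infinite words $$w_n=a^nd^\infty,\quad x_n=a^nbd^\infty,\quad y=a^{-1}b^{-1}d^\infty,\quad z=a^{-1}b^{-1}cd^\infty\qquad(n\ge 0),$$ read from $o$, represent points of $\partial_M Y$; for each $n$ the four points $w_n,x_n,y,z$ are pairwise distinct, and $$[w_n|x_n]_o=[w_n|y]_o=[w_n|z]_o=[x_n|z]_o=[y|z]_o=0,$$ $$(w_n|x_n)_o=n,\qquad (w_n|y)_o=(w_n|z)_o=(x_n|z)_o=0,\qquad (y|z)_o=2,$$ so that $cr_o(w_n,x_n,y,z)=0$ and $[w_n,x_n,y,z]_o=n+2$. Moreover, for every $m\ge 0$, with $o_m=oc^{-m}$,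 $$[w_n|x_n]_{o_m}=[w_n|y]_{o_m}=[x_n|z]_{o_m}=0,\qquad [y|z]_{o_m}=m,\qquad cr_{o_m}(w_n,x_n,y,z)=m.$$ Consequently: 1) for every vertex $o$, the difference $|cr_o(w,x,y,z)-[w,x,y,z]_o|$ is unbounded over quadruples of pairwise distinct points of $\partial_M Y$; 2) $cr_o$ depends on the base point: for every vertex $o$ there are a vertex $o'$ and pairwise distinct $w,x,y,z\in\partial_M Y$ with $cr_o(w,x,y,z)\ne cr_{o'}(w,x,y,z)$. -/

import Mathlib

open scoped NNReal ENNReal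

noncomputable section

namespace MorseCube

/-! ### The Morse boundary of a metric space -/

section MorseBoundary

variable {Y : Type*} [PseudoMetricSpace Y]

/-- `γ`, restricted to `I`, is a `(K, C)`-quasi-geodesic (not necessarily continuous). -/
def IsQuasiGeodesicOn {T : Type*} [PseudoMetricSpace T] (K C : ℝ) (γ : T → Y) (I : Set T) : Prop :=
  ∀ s ∈ I, ∀ t ∈ I,
    K⁻¹ * dist s t - C ≤ dist (γ s) (γ t) ∧ dist (γ s) (γ t) ≤ K * dist s t + C

/-- A set `S` is Morse if for some gauge `N`, every `(K, C)`-quasi-geodesic segment with endpoints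
in `S` stays in the `N K C`-neighbourhood of `S`. -/
def IsMorse (S : Set Y) : Prop :=
  ∃ N : ℝ → ℝ → ℝ, ∀ K C : ℝ, 1 ≤ K → 0 ≤ C → ∀ (a b : ℝ) (γ : ℝ → Y), a ≤ b →
    IsQuasiGeodesicOn K C γ (Set.Icc a b) → γ a ∈ S → γ b ∈ S →
      ∀ t ∈ Set.Icc a b, ∃ s ∈ S, dist (γ t) s ≤ N K C

variable (Y) in
/-- Quasi-geodesic rays `[0, ∞) → Y`. -/
def QuasiGeodesicRay : Type _ :=
  {γ : ℝ≥0 → Y // ∃ K C : ℝ, 1 ≤ K ∧ 0 ≤ C ∧ IsQuasiGeodesicOn K C γ Set.univ}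

variable (Y) in
/-- Two quasi-geodesic rays are asymptotic if they are at finite Hausdorff distance, that is, at
bounded distance up to reparametrization. -/
def asymptotic : Setoid (QuasiGeodesicRay Y) where
  r γ γ' := Metric.hausdorffEDist (Set.range γ.1) (Set.range γ'.1) ≠ ⊤
  iseqv :=
    { refl := fun γ => by simp
      symm := fun {γ γ'} h => by rwa [Metric.hausdorffEDist_comm]
      trans := fun {γ γ' γ''} h h' =>
        ne_top_of_le_ne_top (ENNReal.add_ne_top.2 ⟨h, h'⟩) Metric.hausdorffEDist_triangle }

variable (Y) in
/-- The Morse boundary: asymptoty classes of quasi-geodesic rays that have a representative with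
Morse image. -/
def MorseBoundary : Type _ :=
  {ξ : Quotient (asymptotic Y) //
    ∃ γ : QuasiGeodesicRay Y, Quotient.mk (asymptotic Y) γ = ξ ∧ IsMorse (Set.range γ.1)}

/-- `γ` is a geodesic ray based at `o` that represents `ξ`. -/
def IsGeodesicRep (o : Y) (ξ : MorseBoundary Y) (γ : ℝ≥0 → Y) : Prop :=
  Isometry γ ∧ γ 0 = o ∧
    ∃ r : QuasiGeodesicRay Y, r.1 = γ ∧ Quotient.mk (asymptotic Y) r = ξ.1

end MorseBoundary

/-! ### Right-angled Artin groups and the universal coverings of their Salvetti complexes -/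

section Salvetti

variable {V : Type} (Γ : SimpleGraph V)

/-- The right-angled Artin group `⟨V | [v, w] for all edges {v, w} of Γ⟩`. -/
abbrev RAAG : Type :=
  PresentedGroup {r : FreeGroup V | ∃ v w, Γ.Adj v w ∧ r = FreeGroup.of v * FreeGroup.of w * (FreeGroup.of v)⁻¹ * (FreeGroup.of w)⁻¹}

/-- The generator of the right-angled Artin group given by the vertex `v`. -/
def gen (v : V) : RAAG Γ := PresentedGroup.of v

theorem gen_commute {v w : V} (h : Γ.Adj v w) : Commute (gen Γ v) (gen Γ w) := by
  have : (PresentedGroup.mk {r : FreeGroup V | ∃ v w, Γ.Adj v w ∧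
      r = FreeGroup.of v * FreeGroup.of w * (FreeGroup.of v)⁻¹ * (FreeGroup.of w)⁻¹})
      (FreeGroup.of v * FreeGroup.of w * (FreeGroup.of v)⁻¹ * (FreeGroup.of w)⁻¹) = 1 :=
    PresentedGroup.one_of_mem ⟨v, w, h, rfl⟩
  rw [map_mul, map_mul, map_mul, map_inv, map_inv, mul_inv_eq_one, mul_inv_eq_iff_eq_mul] at this
  exact this.trans rfl

/-- The universal covering of the Salvetti complex of `Γ`: its vertices are the elements of the
group, its cubes are the translates `g · [0, 1] ^ σ` for cliques `σ` of `Γ`, with vertices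
`g * ∏ v ∈ τ, v` for `τ ⊆ σ`. Every point lies in the relative interior of exactly one cube
`g · [0, 1] ^ σ`; it is recorded as the lowest corner `base = g` of that cube and the coordinates
`coord`, which are in `(0, 1)` on `σ` and zero elsewhere. -/
@[ext]
structure Cover where
  base : RAAG Γ
  coord : V → ℝ
  nonneg : ∀ v, 0 ≤ coord v
  lt_one : ∀ v, coord v < 1
  clique : Γ.IsClique {v | coord v ≠ 0}

/-- Coordinates of points in closed cubes: vectors in `[0, 1] ^ V` supported on a clique. -/
@[ext]
structure CubeCoord where
  val : V → ℝ
  mem : ∀ v, val v ∈ Set.Icc (0 : ℝ) 1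
  clique : Γ.IsClique {v | val v ≠ 0}

variable {Γ}

theorem noncommProd_gen_eq (S T : Finset V)
    (hS : (S : Set V).Pairwise (Function.onFun Commute (gen Γ)))
    (hT : (T : Set V).Pairwise (Function.onFun Commute (gen Γ))) (h : S = T) :
    S.noncommProd (gen Γ) hS = T.noncommProd (gen Γ) hT := by
  subst h; rfl

variable [Fintype V]

open scoped Classical in
/-- The directions in which a point of a closed cube lies on the upper face. -/
def CubeCoord.ones (s : CubeCoord Γ) : Finset V := Finset.univ.filter fun v => s.val v = 1

theorem CubeCoord.ones_commute (s : CubeCoord Γ) :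
    (s.ones : Set V).Pairwise (Function.onFun Commute (gen Γ)) := by
  intro v hv w hw hvw
  refine gen_commute Γ (s.clique ?_ ?_ hvw)
  · have : s.val v = 1 := by simpa [CubeCoord.ones] using hv
    simp [this]
  · have : s.val w = 1 := by simpa [CubeCoord.ones] using hw
    simp [this]

open scoped Classical in
/-- The point with coordinates `s` in a closed cube with lowest corner `g`. -/
def cubePoint (g : RAAG Γ) (s : CubeCoord Γ) : Cover Γ where
  base := g * s.ones.noncommProd (gen Γ) s.ones_commute
  coord v := if s.val v = 1 then 0 else s.val v
  nonneg v := by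
    split_ifs
    · exact le_rfl
    · exact (s.mem v).1
  lt_one v := by
    split_ifs with h
    · exact one_pos
    · exact lt_of_le_of_ne (s.mem v).2 h
  clique := s.clique.subset fun v hv => by
    simp only [Set.mem_ofPred_eq] at hv ⊢
    intro h
    simp [h] at hv

/-- The vertex of the complex given by a group element. -/
def vertex (g : RAAG Γ) : Cover Γ where
  base := g
  coord _ := 0
  nonneg _ := le_rfl
  lt_one _ := one_pos
  clique := by simp

/-- `PathLength p q L`: there is a piecewise straight path from `p` to `q` of length `L`, each
straight piece being contained in a closed cube and measured in its Euclidean metric. -/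
inductive PathLength : Cover Γ → Cover Γ → ℝ → Prop
  | refl (p : Cover Γ) : PathLength p p 0
  | step (g : RAAG Γ) (s t : CubeCoord Γ)
      (common_cube : Γ.IsClique ({v | s.val v ≠ 0} ∪ {v | t.val v ≠ 0}))
      {q : Cover Γ} {L : ℝ} (h : PathLength (cubePoint g t) q L) :
      PathLength (cubePoint g s) q (√(∑ v, (s.val v - t.val v) ^ 2) + L)

theorem PathLength.nonneg {p q : Cover Γ} {L : ℝ} (h : PathLength p q L) : 0 ≤ L := by
  induction h with
  | refl => exact le_rfl
  | step g s t hc h ih => positivity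

theorem PathLength.trans {p q r : Cover Γ} {L M : ℝ} (h : PathLength p q L)
    (h' : PathLength q r M) : PathLength p r (L + M) := by
  induction h with
  | refl => simpa using h'
  | step g s t hc h ih => rw [add_assoc]; exact .step g s t hc (ih h')

theorem PathLength.symm {p q : Cover Γ} {L : ℝ} (h : PathLength p q L) : PathLength q p L := by
  induction h with
  | refl p => exact .refl p
  | step g s t hc h ih =>
    have := ih.trans (.step g t s (by rwa [Set.union_comm]) (.refl _))
    rw [add_comm]
    convert this using 3
    simp only [add_zero]
    congr 1
    exact Finset.sum_congr rfl fun v _ => by ring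

/-- The coordinates of the lowest corner of a cube. -/
def CubeCoord.zero : CubeCoord Γ where
  val _ := 0
  mem _ := by simp
  clique := by simp

open scoped Classical in
/-- The coordinates of the upper endpoint of the edge in direction `v`. -/
def CubeCoord.single (v : V) : CubeCoord Γ where
  val w := if w = v then 1 else 0
  mem w := by split_ifs <;> simp
  clique := by
    have : {w | (if w = v then (1 : ℝ) else 0) ≠ 0} = {v} := by ext w; simp
    rw [this]; simp

theorem cubePoint_zero (g : RAAG Γ) : cubePoint g CubeCoord.zero = vertex g := by
  have h : (CubeCoord.zero : CubeCoord Γ).ones = ∅ := by simp [CubeCoord.ones, CubeCoord.zero]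
  ext v
  · simp only [cubePoint, vertex]
    rw [noncommProd_gen_eq _ ∅ _ (by simp) h]; simp
  · simp [cubePoint, vertex, CubeCoord.zero]

theorem cubePoint_single (g : RAAG Γ) (v : V) :
    cubePoint g (CubeCoord.single v) = vertex (g * gen Γ v) := by
  have h : (CubeCoord.single v : CubeCoord Γ).ones = {v} := by
    ext w
    simp only [CubeCoord.ones, Finset.mem_filter, Finset.mem_univ, true_and, Finset.mem_singleton]
    by_cases hw : w = v <;> simp [CubeCoord.single, hw]
  ext w
  · simp only [cubePoint, vertex]
    rw [noncommProd_gen_eq _ {v} _ (by simp) h]; simp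
  · by_cases hw : w = v <;> simp [cubePoint, vertex, CubeCoord.single, hw]

theorem exists_pathLength_vertex_mul (h g : RAAG Γ) :
    ∃ L, PathLength (vertex g) (vertex (g * h)) L := by
  have hh : h ∈ Subgroup.closure (Set.range (gen Γ)) := by
    have := PresentedGroup.closure_range_of
      {r : FreeGroup V | ∃ v w, Γ.Adj v w ∧ r = FreeGroup.of v * FreeGroup.of w * (FreeGroup.of v)⁻¹ * (FreeGroup.of w)⁻¹}
    change h ∈ Subgroup.closure (Set.range (PresentedGroup.of))
    rw [this]; trivial
  induction hh using Subgroup.closure_induction generalizing g with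
  | mem x hx =>
    obtain ⟨v, rfl⟩ := hx
    have := PathLength.step g CubeCoord.zero (CubeCoord.single v)
      (by simpa [CubeCoord.zero] using (CubeCoord.single v : CubeCoord Γ).clique) (.refl _)
    rw [cubePoint_zero, cubePoint_single] at this
    exact ⟨_, this⟩
  | one => exact ⟨0, by simpa using PathLength.refl (vertex g)⟩
  | mul x y _ _ hx hy =>
    obtain ⟨L, hL⟩ := hx g
    obtain ⟨M, hM⟩ := hy (g * x)
    exact ⟨_, hL.trans (by rwa [mul_assoc] at hM)⟩
  | inv x _ hx =>
    obtain ⟨L, hL⟩ := hx (g * x⁻¹)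
    exact ⟨L, by simpa using hL.symm⟩

theorem exists_pathLength_base (p : Cover Γ) : ∃ L, PathLength (vertex p.base) p L := by
  let s : CubeCoord Γ := ⟨p.coord, fun v => ⟨p.nonneg v, (p.lt_one v).le⟩, p.clique⟩
  have hne : ∀ v, s.val v ≠ 1 := fun v => (p.lt_one v).ne
  have hs : cubePoint p.base s = p := by
    have h : s.ones = ∅ := by
      ext v; simp [CubeCoord.ones, hne v]
    ext v
    · simp only [cubePoint]
      rw [noncommProd_gen_eq _ ∅ _ (by simp) h]; simp
    · simp only [cubePoint, if_neg (hne v)]; rfl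
  have := PathLength.step p.base CubeCoord.zero s
    (by simpa [CubeCoord.zero] using s.clique) (.refl _)
  rw [cubePoint_zero, hs] at this
  exact ⟨_, this⟩

theorem exists_pathLength (p q : Cover Γ) : ∃ L, PathLength p q L := by
  obtain ⟨L, hL⟩ := exists_pathLength_base p
  obtain ⟨M, hM⟩ := exists_pathLength_base q
  obtain ⟨R, hR⟩ := exists_pathLength_vertex_mul (p.base⁻¹ * q.base) p.base
  rw [mul_inv_cancel_left] at hR
  exact ⟨_, (hL.symm.trans hR).trans hM⟩

/-- The `CAT(0)` metric: the length metric induced by the Euclidean metrics on the cubes. -/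
instance : PseudoMetricSpace (Cover Γ) where
  dist p q := sInf {L | PathLength p q L}
  dist_self p := le_antisymm (csInf_le ⟨0, fun _ h => PathLength.nonneg h⟩ (.refl p))
    (Real.sInf_nonneg fun _ h => PathLength.nonneg h)
  dist_comm p q := congrArg sInf (Set.ext fun _ => ⟨PathLength.symm, PathLength.symm⟩)
  dist_triangle p q r := by
    refine le_of_forall_pos_le_add fun ε hε => ?_
    obtain ⟨L, hL, hL'⟩ := exists_lt_of_csInf_lt (s := {L | PathLength p q L})
      (exists_pathLength p q) (lt_add_of_pos_right _ (half_pos hε))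
    obtain ⟨M, hM, hM'⟩ := exists_lt_of_csInf_lt (s := {L | PathLength q r L})
      (exists_pathLength q r) (lt_add_of_pos_right _ (half_pos hε))
    have : sInf {L | PathLength p r L} ≤ L + M :=
      csInf_le ⟨0, fun _ h => PathLength.nonneg h⟩ (PathLength.trans hL hM)
    linarith

/-! ### Hyperplanes -/

variable (Γ) in
/-- The edge `(g, v)` joins the vertices `g` and `g * v`. It is opposite to `(g * w, v)` in the
square spanned by `v` and `w` at `g`, for `w` adjacent to `v`. -/
def OppositeEdges (e e' : RAAG Γ × V) : Prop :=
  e'.2 = e.2 ∧ ∃ w, Γ.Adj e.2 w ∧ e'.1 = e.1 * gen Γ w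

variable (Γ) in
/-- Hyperplanes, given as the classes of edges under the equivalence relation generated by being
opposite edges of a square. -/
def Hyperplane : Type := Quot (OppositeEdges Γ)

/-- The hyperplane as a subset of the complex: the union of the midcubes dual to its edges. -/
def Hyperplane.carrier (h : Hyperplane Γ) : Set (Cover Γ) :=
  {p | ∃ v, p.coord v = 1 / 2 ∧ (Quot.mk _ (p.base, v) : Hyperplane Γ) = h}

/-- The halfspaces bounded by `h`: the connected components of its complement. -/
def Hyperplane.IsHalfspace (h : Hyperplane Γ) (H : Set (Cover Γ)) : Prop :=
  ∃ p ∈ h.carrierᶜ, H = connectedComponentIn h.carrierᶜ p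

/-- `h` separates `A` from `B`: they lie in different halfspaces bounded by `h`. -/
def Hyperplane.Separates (h : Hyperplane Γ) (A B : Set (Cover Γ)) : Prop :=
  ∃ H H', h.IsHalfspace H ∧ h.IsHalfspace H' ∧ H ≠ H' ∧ A ⊆ H ∧ B ⊆ H'

/-- The number of hyperplanes that separate the vertex `o` from the hyperplane `k`. -/
def numSeparating (o : RAAG Γ) (k : Hyperplane Γ) : ℕ∞ :=
  Set.encard {h : Hyperplane Γ | h.Separates {vertex o} k.carrier}

/-- The path `γ` crosses the hyperplane `h`. -/
def Crosses (γ : ℝ≥0 → Cover Γ) (h : Hyperplane Γ) : Prop :=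
  ∃ s t, h.Separates {γ s} {γ t}

/-- The (unique) geodesic representative of `ξ` based at `o` crosses `h`. -/
def CrossedFrom (o : RAAG Γ) (ξ : MorseBoundary (Cover Γ)) (h : Hyperplane Γ) : Prop :=
  ∃ γ, IsGeodesicRep (vertex o) ξ γ ∧ Crosses γ h

/-! ### The metric, the products and the cross ratios -/

/-- The hyperplanes crossed by exactly one of the geodesic representatives of `ξ` and `η` based
at `o`. -/
def crossedByOne (o : RAAG Γ) (ξ η : MorseBoundary (Cover Γ)) : Set (Hyperplane Γ) :=
  {h | Xor (CrossedFrom o ξ h) (CrossedFrom o η h)}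

/-- The product `[ξ | η]_o`, the least number of hyperplanes that separate `o` from a hyperplane
crossed by exactly one of the two geodesics; it is `⊤` if there is none. -/
def bracket (o : RAAG Γ) (ξ η : MorseBoundary (Cover Γ)) : ℕ∞ :=
  ⨅ k ∈ crossedByOne o ξ η, numSeparating o k

/-- `e ^ (-n)`, with `e ^ (-∞) = 0`. -/
def expNeg (n : ℕ∞) : ℝ := if n = ⊤ then 0 else Real.exp (-(n.toNat : ℝ))

open scoped Classical in
/-- The function that is `e ^ (-#W(o, k))` on the points whose geodesic representative based at `o`
crosses `k`, and `0` elsewhere. -/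
def bump (o : RAAG Γ) (k : Hyperplane Γ) (ξ : MorseBoundary (Cover Γ)) : ℝ :=
  if CrossedFrom o ξ k then expNeg (numSeparating o k) else 0

/-- The metric `d_o` on the Morse boundary. -/
def boundaryDist (o : RAAG Γ) (ξ η : MorseBoundary (Cover Γ)) : ℝ :=
  ⨆ k : Hyperplane Γ, |bump o k ξ - bump o k η|

/-- The product `(ξ | η)_o`, the number of hyperplanes that separate `o` from `ξ` and `η`. -/
def gromovProd (o : RAAG Γ) (ξ η : MorseBoundary (Cover Γ)) : ℕ∞ :=
  Set.encard {h : Hyperplane Γ | ∃ γ γ' : ℝ≥0 → Cover Γ,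
    IsGeodesicRep (vertex o) ξ γ ∧ IsGeodesicRep (vertex o) η γ' ∧
      ∃ T : ℝ≥0, h.Separates {vertex o} (γ '' Set.Ici T ∪ γ' '' Set.Ici T)}

/-- The cross ratio `cr_o`; it is meaningful where the four products are finite. -/
def cr (o : RAAG Γ) (w x y z : MorseBoundary (Cover Γ)) : ℤ :=
  (bracket o w x).toNat + (bracket o y z).toNat - (bracket o w y).toNat - (bracket o x z).toNat

/-- The cross ratio of Beyrer, Fioravanti and Medici, computed at the vertex `o`; it is meaningful
where the four products are finite. -/
def bfm (o : RAAG Γ) (w x y z : MorseBoundary (Cover Γ)) : ℤ :=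
  (gromovProd o w x).toNat + (gromovProd o y z).toNat
    - (gromovProd o w y).toNat - (gromovProd o x z).toNat

/-- The infinite word `u`, whose letters are generators or their inverses, read from the vertex `o`,
represents `ξ`: the path of its prefixes is asymptotic to `ξ`. -/
def Represents (o : RAAG Γ) (u : Stream' (RAAG Γ)) (ξ : MorseBoundary (Cover Γ)) : Prop :=
  ∃ r : QuasiGeodesicRay (Cover Γ), Quotient.mk (asymptotic (Cover Γ)) r = ξ.1 ∧
    r.1 = fun t => vertex (o * (u.take ⌊t⌋₊).prod)

end Salvetti

/-! ### The tree of 3-dimensional flats -/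

/-- The disjoint union of a triangle `{0, 1, 2}` and an isolated vertex `3`. -/
def triangleAndPoint : SimpleGraph (Fin 4) where
  Adj i j := i ≠ j ∧ i ≠ 3 ∧ j ≠ 3
  symm := ⟨fun _ _ h => ⟨h.1.symm, h.2.2, h.2.1⟩⟩
  loopless := ⟨fun _ h => h.1 rfl⟩

/-- The group `ℤ³ * ℤ = ⟨a, b, c, d | [a, b] = [b, c] = [a, c] = 1⟩`. -/
abbrev G : Type := RAAG triangleAndPoint

abbrev a : G := gen triangleAndPoint 0
abbrev b : G := gen triangleAndPoint 1
abbrev c : G := gen triangleAndPoint 2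
abbrev d : G := gen triangleAndPoint 3

/-- The Morse boundary of the tree of 3-dimensional flats. -/
abbrev Bdry : Type := MorseBoundary (Cover triangleAndPoint)

/-- The infinite word `u v v v ⋯`. -/
def eventually (u : List G) (v : G) : Stream' G := u ++ₛ Stream'.const v

end MorseCube

end

/-!
The complex is a tree of flats: each coset of `ℤ³` spans a flat, each coset of `⟨d⟩` spans a line,
and two of these meet in at most one vertex, which is a cut point. So each flat or line is the
image of a projection `proj` that is constant on every cube outside it. The projection of a vertex
is the first syllable `lead` of the normal form in the free product `ℤ³ * ℤ`, which is where the
word problem of the group enters. The projections do not increase distances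
(`dist_proj_le`), so that flats are isometrically embedded (`dist_flat`). A path between points
with different projections has to pass through both projections (`dist_gate`), so that projections
map geodesics to straight segments (`wbtw_proj`).

A hyperplane `h` is a coordinate hyperplane of its flat or line pulled back by the projection, so
that it is the set where the function `h.level` is `1 / 2`, and its halfspaces are the two sides
of that set (`separates_iff`). On a geodesic, a level stays between its values at the endpoints
(`level_between`), so that no geodesic between vertices crosses a hyperplane that does not
separate its endpoints.

The points in question are the ends of the rays `q, q d, q d², …`, for vertices `q` of the flat
through the base point `p`. These rays are Morse since they run through cut points near which a
quasi-geodesic has to pass before and after an excursion (`isMorse_of_gates`). A geodesic from `p`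
to such a point is forced through the same cut points, and crosses exactly the hyperplanes between
`p` and `q` inside the flat and the `d`-edges behind `q` (`crossedFrom_iff`). With `q = p *
lattice false k`, all products can be read off from the integral vectors `k`: the Gromov product
counts the hyperplanes of the flat between `p` and both exit vertices (`gromovProd_eq`), whereas
the bracket vanishes as soon as one hyperplane adjacent to `p` lies before exactly one of them
(`bracket_eq_zero`). Moving the base point by `c ^ (-m)` changes the bracket only of the two
points whose exits differ in the direction `c` (`bracket_eq_natCast`).
-/

noncomputable section

namespace MorseCube

/-! ### Normal forms in the free product -/

/-- The free factor that a generator belongs to: `false` for `a, b, c` and `true` for `d`. -/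
def block (v : Fin 4) : Bool := decide (v = 3)

theorem adj_iff {v w : Fin 4} : triangleAndPoint.Adj v w ↔ v ≠ w ∧ block v = block w := by
  have : triangleAndPoint.Adj v w ↔ v ≠ w ∧ v ≠ 3 ∧ w ≠ 3 := Iff.rfl
  rw [this]; clear this; revert v w; decide

theorem gen_commute_of_block {v w : Fin 4} (h : block v = block w) :
    Commute (gen triangleAndPoint v) (gen triangleAndPoint w) := by
  by_cases hvw : v = w
  · subst hvw; exact Commute.refl _
  · exact gen_commute _ (adj_iff.2 ⟨hvw, h⟩)

/-- The homomorphism from the `v`-th factor of `ℤ⁴` to `G` that hits the generator `v` if `v` lies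
in the block `i`, and is trivial otherwise. -/
def generatorHom (i : Bool) (v : Fin 4) : Multiplicative ℤ →* G :=
  if block v = i then zpowersHom G (gen triangleAndPoint v) else 1

theorem generatorHom_commute (i : Bool) :
    Pairwise fun v w => ∀ x y, Commute (generatorHom i v x) (generatorHom i w y) := by
  intro v w _ x y
  by_cases hv : block v = i <;> by_cases hw : block w = i
  · simp only [generatorHom, hv, hw, if_true, zpowersHom_apply]
    exact (gen_commute_of_block (hv.trans hw.symm)).zpow_zpow _ _
  all_goals simp [generatorHom, hv, hw]

/-- The homomorphism `ℤ⁴ → G` that maps the basis vectors of the block `i` to the generators and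
kills the others. Both free factors are images of the same group `ℤ⁴`, so that they can be treated
alike. -/
def latticeHom (i : Bool) : (Fin 4 → Multiplicative ℤ) →* G :=
  MonoidHom.noncommPiCoprod (generatorHom i) (generatorHom_commute i)

theorem latticeHom_mulSingle (i : Bool) (v : Fin 4) (n : ℤ) :
    latticeHom i (Pi.mulSingle v (Multiplicative.ofAdd n)) =
      if block v = i then gen triangleAndPoint v ^ n else 1 := by
  rw [latticeHom, MonoidHom.noncommPiCoprod_mulSingle, generatorHom]
  split_ifs <;> simp

/-- The element `∏ v ^ u v` of the free factor `i`. -/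
def lattice (i : Bool) (u : Fin 4 → ℤ) : G := latticeHom i fun v => Multiplicative.ofAdd (u v)

/-- The restriction of a vector to the coordinates in the block `i`. -/
def restrict {R : Type*} [Zero R] (i : Bool) (u : Fin 4 → R) : Fin 4 → R :=
  fun v => if block v = i then u v else 0

theorem lattice_add (i : Bool) (u u' : Fin 4 → ℤ) :
    lattice i (u + u') = lattice i u * lattice i u' := by
  simp only [lattice, ← map_mul]; rfl

@[simp] theorem lattice_zero (i : Bool) : lattice i 0 = 1 := map_one (latticeHom i)

theorem lattice_neg (i : Bool) (u : Fin 4 → ℤ) : lattice i (-u) = (lattice i u)⁻¹ := by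
  rw [eq_inv_iff_mul_eq_one, ← lattice_add]; simp

theorem lattice_single (i : Bool) (v : Fin 4) (n : ℤ) :
    lattice i (Pi.single v n) = if block v = i then gen triangleAndPoint v ^ n else 1 := by
  have : (fun w => Multiplicative.ofAdd ((Pi.single v n : Fin 4 → ℤ) w)) =
      Pi.mulSingle v (Multiplicative.ofAdd n) := by
    ext w; by_cases h : w = v
    · subst h; simp
    · simp [h]
  rw [lattice, this, latticeHom_mulSingle]

open Monoid.CoprodI (Word of) in
/-- The last syllable of a reduced word if it lies in the free factor `i`, and `1` otherwise. -/
def lastSyllable {M : Type*} [Monoid M] (i : Bool) (w : Word fun _ : Bool => M) : M :=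
  match w.toList.getLast? with
  | none => 1
  | some l => if l.1 = i then l.2 else 1

section Word

open Monoid.CoprodI

variable {M : Type*} [Monoid M] [DecidableEq M]

open scoped Classical in
theorem lastSyllable_rcons (i j : Bool) (p : Word.Pair (fun _ : Bool => M) j) :
    lastSyllable i (Word.rcons p) =
      if p.tail = Word.empty then (if j = i then p.head else 1) else lastSyllable i p.tail := by
  obtain ⟨m, w, hw⟩ := p
  by_cases hm : m = 1
  · by_cases h : w = Word.empty
    · subst h; simp [Word.rcons, hm, lastSyllable]
    · simp [Word.rcons, hm, h]
  · by_cases h : w = Word.empty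
    · subst h; simp [Word.rcons, hm, lastSyllable, Word.cons]
    · have h' : w.toList ≠ [] := fun h0 => h (Word.ext h0)
      simp only [Word.rcons, hm, h, dite_false, if_false, lastSyllable, Word.cons]
      rw [List.getLast?_cons_of_ne_nil h']

theorem lastSyllable_of_smul (i j : Bool) (m : M) (w : Word fun _ : Bool => M)
    (h : j ≠ i ∨ (Word.equivPair j w).tail ≠ Word.empty) :
    lastSyllable i ((of (M := fun _ : Bool => M) (i := j) m) • w) = lastSyllable i w := by
  conv_rhs => rw [← (Word.equivPair j).symm_apply_apply w, Word.equivPair_symm]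
  rw [Word.of_smul_def, lastSyllable_rcons, lastSyllable_rcons]
  rcases h with h | h <;> simp [h]

theorem lastSyllable_of_smul_empty (i j : Bool) (m : M) :
    lastSyllable i ((of (M := fun _ : Bool => M) (i := j) m) • Word.empty) =
      if j = i then m else 1 := by
  rw [Word.of_smul_def, lastSyllable_rcons,
    Word.equivPair_eq_of_fstIdx_ne (by simp [Word.fstIdx, Word.empty])]
  simp

end Word

/-- The map from `G` to the free product of two copies of `ℤ⁴`. -/
def toFreeProduct : G →* Monoid.CoprodI fun _ : Bool => Fin 4 → Multiplicative ℤ :=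
  PresentedGroup.toGroup
    (f := fun v => Monoid.CoprodI.of (M := fun _ : Bool => Fin 4 → Multiplicative ℤ) (i := block v)
      (Pi.mulSingle v (Multiplicative.ofAdd 1))) <| by
    rintro _ ⟨v, w, h, rfl⟩
    obtain ⟨-, h⟩ := adj_iff.1 h
    simp only [map_mul, map_inv, FreeGroup.lift_apply_of, h]
    rw [← map_mul, mul_comm, map_mul]
    simp

theorem toFreeProduct_gen (v : Fin 4) : toFreeProduct (gen triangleAndPoint v) =
    Monoid.CoprodI.of (M := fun _ : Bool => Fin 4 → Multiplicative ℤ) (i := block v)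
      (Pi.mulSingle v (Multiplicative.ofAdd 1)) :=
  PresentedGroup.toGroup.of _

theorem lift_latticeHom_toFreeProduct (g : G) :
    Monoid.CoprodI.lift latticeHom (toFreeProduct g) = g := by
  suffices h : (Monoid.CoprodI.lift latticeHom).comp toFreeProduct = MonoidHom.id G from
    DFunLike.congr_fun h g
  refine PresentedGroup.ext fun v => ?_
  have := toFreeProduct_gen v
  rw [gen] at this
  simp [this, latticeHom_mulSingle, gen]

theorem toFreeProduct_latticeHom (i : Bool) (u : Fin 4 → Multiplicative ℤ) :
    toFreeProduct (latticeHom i u) =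
      Monoid.CoprodI.of (M := fun _ : Bool => Fin 4 → Multiplicative ℤ) (i := i)
        fun v => if block v = i then u v else 1 := by
  let r : (Fin 4 → Multiplicative ℤ) →* (Fin 4 → Multiplicative ℤ) :=
    { toFun := fun u v => if block v = i then u v else 1
      map_one' := by ext; simp
      map_mul' := fun u u' => by ext v; by_cases h : block v = i <;> simp [h] }
  suffices h : toFreeProduct.comp (latticeHom i) =
      (Monoid.CoprodI.of (M := fun _ : Bool => Fin 4 → Multiplicative ℤ) (i := i)).comp r from
    DFunLike.congr_fun h u
  refine MonoidHom.pi_ext fun v x => ?_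
  obtain ⟨n, rfl⟩ := Multiplicative.ofAdd.surjective x
  have hr : r (Pi.mulSingle v (Multiplicative.ofAdd n)) =
      if block v = i then Pi.mulSingle v (Multiplicative.ofAdd 1) ^ n else 1 := by
    ext w
    by_cases hw : w = v
    · subst hw; by_cases h : block w = i <;> simp [r, h, ← ofAdd_zsmul]
    · by_cases h : block v = i <;> simp [r, h, hw]
  rw [MonoidHom.comp_apply, MonoidHom.comp_apply, latticeHom_mulSingle, hr]
  by_cases h : block v = i
  · subst h; simp [toFreeProduct_gen]
  · simp [h]

/-- The exponents of the first syllable of the normal form of `g` if it lies in the free factor `i`,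
and `0` otherwise. It is read off from the last syllable of `g⁻¹`, since the free product acts on
reduced words from the left. The element `lattice i (lead i g)` is the gate of `g` in the free
factor `i`, the vertex of that factor nearest to `g`. -/
def lead (i : Bool) (g : G) : Fin 4 → ℤ := fun v =>
  if block v = i then
    -(lastSyllable (M := Fin 4 → Multiplicative ℤ) i
      ((toFreeProduct g)⁻¹ • Monoid.CoprodI.Word.empty) v).toAdd
  else 0

@[simp] theorem lead_lattice (i : Bool) (u : Fin 4 → ℤ) : lead i (lattice i u) = restrict i u := by
  ext v
  rw [lead, lattice, toFreeProduct_latticeHom, ← map_inv, lastSyllable_of_smul_empty, restrict]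
  by_cases h : block v = i <;> simp [h]

/-- Right multiplication by an element of a free factor does not change the leading syllable, unless
both elements lie in the free factor `i`. -/
theorem lead_mul_lattice (i j : Bool) (g : G) (u : Fin 4 → ℤ)
    (h : j ≠ i ∨ ∀ u', g ≠ lattice i u') : lead i (g * lattice j u) = lead i g := by
  ext v
  rw [lead, lead, lattice, map_mul, mul_inv_rev, toFreeProduct_latticeHom, ← map_inv, mul_smul,
    lastSyllable_of_smul]
  by_cases hj : j = i
  · subst hj
    right
    intro h0
    set w := (toFreeProduct g)⁻¹ •
      (Monoid.CoprodI.Word.empty : Monoid.CoprodI.Word fun _ : Bool => Fin 4 → Multiplicative ℤ)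
    have h1 := Monoid.CoprodI.Word.equivPair_head_smul_equivPair_tail (i := j) w
    rw [h0] at h1
    have h2 := congrArg Monoid.CoprodI.Word.prod h1
    simp only [w, Monoid.CoprodI.Word.prod_smul, Monoid.CoprodI.Word.prod_empty, mul_one] at h2
    have h3 := congrArg (Monoid.CoprodI.lift latticeHom) h2
    rw [map_inv, lift_latticeHom_toFreeProduct, Monoid.CoprodI.lift_of] at h3
    refine (h.resolve_left (by simp))
      (-fun v => (Monoid.CoprodI.Word.equivPair j w).head v |>.toAdd) ?_
    rw [lattice_neg]
    exact (inv_inv g).symm.trans (congrArg _ h3.symm)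
  · exact Or.inl hj

theorem lattice_restrict (i : Bool) (u : Fin 4 → ℤ) : lattice i (restrict i u) = lattice i u := by
  rw [← lift_latticeHom_toFreeProduct (lattice i (restrict i u)),
    ← lift_latticeHom_toFreeProduct (lattice i u), lattice, lattice, toFreeProduct_latticeHom,
    toFreeProduct_latticeHom]
  congr 2
  ext v; by_cases h : block v = i <;> simp [restrict, h]

theorem restrict_add {R : Type*} [AddZeroClass R] (i : Bool) (u u' : Fin 4 → R) :
    restrict i (u + u') = restrict i u + restrict i u' := by
  ext v; by_cases h : block v = i <;> simp [restrict, h]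

@[simp] theorem lead_one (i : Bool) : lead i 1 = 0 := by
  rw [← lattice_zero i, lead_lattice]; ext v; simp [restrict]

theorem gen_eq_lattice (v : Fin 4) :
    gen triangleAndPoint v = lattice (block v) (Pi.single v 1) := by
  simp [lattice_single]

theorem induction_lattice {P : G → Prop} (one : P 1)
    (mul : ∀ g i u, P g → P (g * lattice i u)) (g : G) : P g := by
  have hg : g ∈ Subgroup.closure (Set.range (gen triangleAndPoint)) := by
    have := PresentedGroup.closure_range_of {r : FreeGroup (Fin 4) | ∃ v w,
      triangleAndPoint.Adj v w ∧
        r = FreeGroup.of v * FreeGroup.of w * (FreeGroup.of v)⁻¹ * (FreeGroup.of w)⁻¹}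
    change g ∈ Subgroup.closure (Set.range (PresentedGroup.of))
    rw [this]; trivial
  induction hg using Subgroup.closure_induction_right with
  | one => exact one
  | mul_right x y hy hz h =>
    obtain ⟨v, rfl⟩ := hz
    rw [gen_eq_lattice]; exact mul _ _ _ h
  | mul_inv_cancel x y hy hz h =>
    obtain ⟨v, rfl⟩ := hz
    rw [gen_eq_lattice, ← lattice_neg]; exact mul _ _ _ h

theorem lead_lattice_mul (i : Bool) (u : Fin 4 → ℤ) (g : G) :
    lead i (lattice i u * g) = restrict i u + lead i g := by
  induction g using induction_lattice with
  | one => simp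
  | mul g j w ih =>
    by_cases h : j ≠ i ∨ ∀ u', g ≠ lattice i u'
    · rw [lead_mul_lattice i j g w h, ← ih, ← mul_assoc, lead_mul_lattice]
      refine h.imp id fun h u' hu => h (-u + u') ?_
      rw [lattice_add, ← hu, lattice_neg, inv_mul_cancel_left]
    · push Not at h
      obtain ⟨rfl, u', rfl⟩ := h
      rw [← lattice_add, ← lattice_add, lead_lattice, lead_lattice, restrict_add]

theorem lead_lattice_of_ne {i j : Bool} (h : j ≠ i) (u : Fin 4 → ℤ) : lead i (lattice j u) = 0 := by
  rw [← one_mul (lattice j u), lead_mul_lattice i j 1 u (Or.inl h), lead_one]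

/-! ### Flats and the projections onto them -/

/-- `ℝ⁴` with the Euclidean metric. -/
abbrev Vec : Type := EuclideanSpace ℝ (Fin 4)

/-- The orthogonal projection of `ℝ⁴` to the coordinates in the block `i`. -/
def truncate (i : Bool) (u : Vec) : Vec := WithLp.toLp 2 (restrict i u)

theorem truncate_apply (i : Bool) (u : Vec) (v : Fin 4) :
    truncate i u v = if block v = i then u v else 0 := rfl

@[simp] theorem truncate_truncate (i : Bool) (u : Vec) :
    truncate i (truncate i u) = truncate i u := by
  ext v; by_cases h : block v = i <;> simp [truncate_apply, h]

theorem dist_truncate_le (i : Bool) (u u' : Vec) :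
    dist (truncate i u) (truncate i u') ≤ dist u u' := by
  rw [EuclideanSpace.dist_eq, EuclideanSpace.dist_eq]
  refine Real.sqrt_le_sqrt (Finset.sum_le_sum fun v _ => ?_)
  by_cases h : block v = i
  · simp [truncate_apply, h]
  · simp [truncate_apply, h]

theorem isClique_of_block {S : Set (Fin 4)} {i : Bool} (h : ∀ v ∈ S, block v = i) :
    triangleAndPoint.IsClique S := fun v hv w hw hvw =>
  adj_iff.2 ⟨hvw, (h v hv).trans (h w hw).symm⟩

theorem exists_block_of_isClique {S : Set (Fin 4)} (h : triangleAndPoint.IsClique S) :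
    ∃ i, ∀ v ∈ S, block v = i := by
  by_cases hS : S.Nonempty
  · obtain ⟨w, hw⟩ := hS
    refine ⟨block w, fun v hv => ?_⟩
    by_cases hvw : v = w
    · rw [hvw]
    · exact (adj_iff.1 (h hv hw hvw)).2
  · exact ⟨true, fun v hv => (hS ⟨v, hv⟩).elim⟩

/-- The point with coordinates `u` in the flat `p · ℝ³` or the line `p · ℝ` that is spanned by the
cosets of the free factor `i`. Only the coordinates in the block `i` matter. -/
def flat (i : Bool) (p : G) (u : Vec) : Cover triangleAndPoint where
  base := p * lattice i fun v => ⌊u v⌋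
  coord := restrict i fun v => Int.fract (u v)
  nonneg v := by unfold restrict; split_ifs <;> simp
  lt_one v := by unfold restrict; split_ifs <;> simp [Int.fract_lt_one]
  clique := isClique_of_block (i := i) fun v hv => by
    by_contra h; simp [restrict, h] at hv

open scoped Classical in
/-- The nearest point projection to the flat `p · ℝ³` or the line `p · ℝ` of the free factor `i`, in
coordinates. -/
def proj (i : Bool) (p : G) (x : Cover triangleAndPoint) : Vec := WithLp.toLp 2 fun v =>
  lead i (p⁻¹ * x.base) v + if ∃ k, p⁻¹ * x.base = lattice i k then restrict i x.coord v else 0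

/-- An integral vector as a real vector. -/
def intVec (k : Fin 4 → ℤ) : Vec := WithLp.toLp 2 fun v => (k v : ℝ)

@[simp] theorem intVec_apply (k : Fin 4 → ℤ) (v : Fin 4) : intVec k v = k v := rfl

theorem flat_truncate (i : Bool) (p : G) (u : Vec) : flat i p (truncate i u) = flat i p u := by
  have h : lattice i (fun v => ⌊truncate i u v⌋) = lattice i (fun v => ⌊u v⌋) := by
    rw [← lattice_restrict i fun v => ⌊u v⌋]
    congr 1; ext v; by_cases h : block v = i <;> simp [truncate_apply, restrict, h]
  ext v
  · exact congrArg (p * ·) h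
  · by_cases h : block v = i <;> simp [flat, truncate_apply, restrict, h]

theorem flat_mul_lattice (i : Bool) (p : G) (k : Fin 4 → ℤ) (u : Vec) :
    flat i (p * lattice i k) u = flat i p (intVec k + u) := by
  ext v
  · simp only [flat, mul_assoc, ← lattice_add]
    congr 2; ext v; simp
  · by_cases h : block v = i <;> simp [flat, restrict, h]

theorem flat_intVec (i : Bool) (p : G) (k : Fin 4 → ℤ) :
    flat i p (intVec k) = vertex (p * lattice i k) := by
  ext v
  · simp [flat, vertex]
  · simp [flat, vertex, restrict]

theorem flat_zero (i : Bool) (p : G) : flat i p 0 = vertex p := by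
  have : (0 : Vec) = intVec 0 := by ext; simp
  rw [this, flat_intVec]; simp

theorem proj_flat (i : Bool) (p : G) (u : Vec) : proj i p (flat i p u) = truncate i u := by
  ext v
  have h : ∃ k, p⁻¹ * (flat i p u).base = lattice i k := ⟨_, inv_mul_cancel_left _ _⟩
  simp only [proj, h, if_true, truncate_apply]
  simp only [flat, inv_mul_cancel_left, lead_lattice]
  by_cases h : block v = i <;> simp [restrict, h]

theorem flat_proj_flat (i : Bool) (p : G) (u : Vec) :
    flat i p (proj i p (flat i p u)) = flat i p u := by
  rw [proj_flat, flat_truncate]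

/-- A flat is either contained in the flat that is projected to, or projected to a vertex. -/
theorem proj_flat_of_disjoint (i j : Bool) (p g : G) (h : j ≠ i ∨ ∀ k, g ≠ p * lattice i k)
    (u : Vec) : proj i p (flat j g u) = intVec (lead i (p⁻¹ * g)) := by
  ext v
  have h' : j ≠ i ∨ ∀ k, p⁻¹ * g ≠ lattice i k :=
    h.imp id fun h k hk => h k (by rw [← hk, mul_inv_cancel_left])
  have h1 : lead i (p⁻¹ * (flat j g u).base) = lead i (p⁻¹ * g) := by
    simp only [flat, ← mul_assoc]
    exact lead_mul_lattice i j _ _ h'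
  simp only [proj, h1, intVec_apply]
  rw [add_eq_left]
  split_ifs with hk
  · by_cases hj : j = i
    · subst hj
      obtain ⟨k, hk⟩ := hk
      refine (h'.resolve_left (by simp) (k + -fun v => ⌊u v⌋) ?_).elim
      rw [lattice_add, ← hk, lattice_neg]
      simp [flat, mul_assoc]
    · by_cases hv : block v = i
      · have : i ≠ j := Ne.symm hj
        simp [flat, restrict, hv, this]
      · simp [restrict, hv]
  · rfl

theorem noncommProd_gen_eq_lattice (i : Bool) (S : Finset (Fin 4)) (hS : ∀ v ∈ S, block v = i)
    (hc : (S : Set (Fin 4)).Pairwise (Function.onFun Commute (gen triangleAndPoint))) :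
    S.noncommProd (gen triangleAndPoint) hc = lattice i fun v => if v ∈ S then 1 else 0 := by
  induction S using Finset.induction_on with
  | empty => exact (lattice_zero i).symm
  | insert v S hv ih =>
    rw [Finset.noncommProd_insert_of_notMem _ _ _ _ hv, ih fun w hw => hS w (by simp [hw])]
    have h : gen triangleAndPoint v = lattice i (Pi.single v 1) := by
      rw [gen_eq_lattice, hS v (by simp)]
    rw [h, ← lattice_add]
    congr 1; ext w
    by_cases hw : w = v
    · subst hw; simp [hv]
    · simp [hw]

theorem cubePoint_eq_flat (i : Bool) (g : G) (s : CubeCoord triangleAndPoint)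
    (hs : ∀ v, s.val v ≠ 0 → block v = i) : cubePoint g s = flat i g (WithLp.toLp 2 s.val) := by
  have h1 : ∀ v, s.val v = 1 → ⌊s.val v⌋ = 1 := fun v h => by simp [h]
  have h0 : ∀ v, s.val v ≠ 1 → ⌊s.val v⌋ = 0 := fun v h => by
    rw [Int.floor_eq_zero_iff]; exact ⟨(s.mem v).1, lt_of_le_of_ne (s.mem v).2 h⟩
  ext v
  · simp only [cubePoint, flat]
    rw [noncommProd_gen_eq_lattice i]
    · congr 2; ext v
      by_cases h : s.val v = 1
      · simp [CubeCoord.ones, h]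
      · simp [CubeCoord.ones, h, h0 v h]
    · intro v hv
      refine hs v ?_
      have : s.val v = 1 := by simpa [CubeCoord.ones] using hv
      simp [this]
  · simp only [cubePoint, flat, restrict]
    by_cases h : s.val v = 1
    · simp [h]
    · by_cases hb : block v = i
      · simp [h, hb, Int.fract, h0 v h]
      · have : s.val v = 0 := by_contra fun h => hb (hs v h)
        simp [hb, this]

/-- Induction over piecewise straight paths whose pieces are written in coordinates of flats. -/
theorem pathLength_induction {P : Cover triangleAndPoint → Cover triangleAndPoint → ℝ → Prop}
    (refl : ∀ x, P x x 0)
    (step : ∀ i g (u u' : Vec) y L, (∀ v, u v ∈ Set.Icc (0 : ℝ) 1) →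
      (∀ v, u' v ∈ Set.Icc (0 : ℝ) 1) →
      PathLength (flat i g u') y L → P (flat i g u') y L → P (flat i g u) y (dist u u' + L))
    {x y : Cover triangleAndPoint} {L : ℝ} (h : PathLength x y L) : P x y L := by
  induction h with
  | refl x => exact refl x
  | step g s t hc h ih =>
    obtain ⟨i, hi⟩ := exists_block_of_isClique hc
    have hs := cubePoint_eq_flat i g s fun v hv => hi v (Or.inl hv)
    have ht := cubePoint_eq_flat i g t fun v hv => hi v (Or.inr hv)
    rw [ht] at h ih
    rw [hs]
    have := step i g (WithLp.toLp 2 s.val) (WithLp.toLp 2 t.val) _ _ s.mem t.mem h ih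
    simpa only [EuclideanSpace.dist_eq, Real.dist_eq, sq_abs] using this

theorem dist_le_of_pathLength {x y : Cover triangleAndPoint} {L : ℝ} (h : PathLength x y L) :
    dist x y ≤ L := csInf_le ⟨0, fun _ h => PathLength.nonneg h⟩ h

theorem le_dist_of_forall_pathLength {x y : Cover triangleAndPoint} {c : ℝ}
    (h : ∀ L, PathLength x y L → c ≤ L) : c ≤ dist x y :=
  le_csInf (exists_pathLength x y) h

theorem dist_flat_le_of_cube (i : Bool) (p : G) (u u' : Vec) (k : Fin 4 → ℤ)
    (hu : ∀ v, u v ∈ Set.Icc (k v : ℝ) (k v + 1)) (hu' : ∀ v, u' v ∈ Set.Icc (k v : ℝ) (k v + 1)) :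
    dist (flat i p u) (flat i p u') ≤ dist u u' := by
  have key : ∀ w : Vec, (∀ v, w v ∈ Set.Icc (k v : ℝ) (k v + 1)) →
      ∃ s : CubeCoord triangleAndPoint, (∀ v, s.val v = restrict i (w - intVec k) v) ∧
        cubePoint (p * lattice i k) s = flat i p w := by
    intro w hw
    have hs : ∀ v, restrict i (w - intVec k) v ≠ 0 → block v = i := fun v hv => by
      by_contra h; simp [restrict, h] at hv
    refine ⟨⟨restrict i (w - intVec k), fun v => ?_, isClique_of_block hs⟩, fun v => rfl, ?_⟩
    · have := hw v
      simp only [Set.mem_Icc] at this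
      unfold restrict; split_ifs
      · change w v - k v ∈ Set.Icc (0 : ℝ) 1
        constructor <;> linarith
      · simp
    · rw [cubePoint_eq_flat i _ _ hs, flat_mul_lattice, ← flat_truncate, ← flat_truncate i p w]
      congr 1; ext v; by_cases h : block v = i <;> simp [truncate_apply, restrict, h]
  obtain ⟨s, hs, hs'⟩ := key u hu
  obtain ⟨t, ht, ht'⟩ := key u' hu'
  have hc : triangleAndPoint.IsClique ({v | s.val v ≠ 0} ∪ {v | t.val v ≠ 0}) := by
    refine isClique_of_block (i := i) fun v hv => ?_
    by_contra h
    simp [hs, ht, restrict, h] at hv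
  have := dist_le_of_pathLength (PathLength.step (p * lattice i k) s t hc (.refl _))
  rw [hs', ht', add_zero] at this
  refine this.trans ?_
  rw [EuclideanSpace.dist_eq]
  refine Real.sqrt_le_sqrt (Finset.sum_le_sum fun v _ => ?_)
  rw [hs, ht, Real.dist_eq, sq_abs]
  by_cases h : block v = i
  · simp [restrict, h]
  · simpa [restrict, h] using sq_nonneg _

theorem eventually_common_unit_interval (x : ℝ) :
    ∀ᶠ y in nhds x, ∃ k : ℤ, x ∈ Set.Icc (k : ℝ) (k + 1) ∧ y ∈ Set.Icc (k : ℝ) (k + 1) := by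
  have h1 : ∀ᶠ y in nhds x, y < (⌊x⌋ : ℝ) + 1 := eventually_lt_nhds (Int.lt_floor_add_one x)
  have h2 : ∀ᶠ y in nhds x, (⌈x⌉ : ℝ) - 1 < y :=
    eventually_gt_nhds (by linarith [Int.ceil_lt_add_one x])
  filter_upwards [h1, h2] with y h1 h2
  rcases le_total x y with h | h
  · exact ⟨⌊x⌋, ⟨Int.floor_le x, (Int.lt_floor_add_one x).le⟩, (Int.floor_le x).trans h, h1.le⟩
  · refine ⟨⌈x⌉ - 1, ?_, ?_⟩ <;> push_cast
    · exact ⟨by linarith [Int.ceil_lt_add_one x], by linarith [Int.le_ceil x]⟩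
    · exact ⟨h2.le, by linarith [Int.le_ceil x]⟩

theorem eventually_dist_flat_le (i : Bool) (p : G) (u : Vec) :
    ∀ᶠ u' in nhds u, dist (flat i p u) (flat i p u') ≤ dist u u' := by
  have h : ∀ᶠ u' in nhds u, ∀ v, ∃ k : ℤ,
      u v ∈ Set.Icc (k : ℝ) (k + 1) ∧ u' v ∈ Set.Icc (k : ℝ) (k + 1) := by
    rw [Filter.eventually_all]
    intro v
    have hc : Continuous fun u : Vec => u v := by fun_prop
    exact hc.continuousAt.eventually (eventually_common_unit_interval (u v))
  filter_upwards [h] with u' hu'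
  choose k hk using hu'
  exact dist_flat_le_of_cube i p u u' k (fun v => (hk v).1) fun v => (hk v).2

/-- A map on a convex space is `1`-Lipschitz if it does not increase the distances from any point to
its neighbours. -/
theorem dist_le_of_eventually {F Y : Type*} [NormedAddCommGroup F] [NormedSpace ℝ F]
    [PseudoMetricSpace Y] {f : F → Y} (hf : ∀ u, ∀ᶠ u' in nhds u, dist (f u) (f u') ≤ dist u u')
    (u u' : F) : dist (f u) (f u') ≤ dist u u' := by
  have hcont : Continuous f := by
    refine continuous_iff_continuousAt.2 fun u => ?_
    rw [ContinuousAt, tendsto_iff_dist_tendsto_zero]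
    have h0 : Filter.Tendsto (fun u' => dist u u') (nhds u) (nhds 0) := by
      have : Continuous fun u' => dist u u' := by fun_prop
      simpa using this.tendsto u
    refine squeeze_zero' (Filter.Eventually.of_forall fun _ => dist_nonneg) ?_ h0
    filter_upwards [hf u] with u' h
    rwa [dist_comm]
  let ℓ : ℝ → F := fun t => AffineMap.lineMap u u' t
  have hℓ : Continuous ℓ := AffineMap.lineMap_continuous
  have hℓd : ∀ s t, dist (ℓ s) (ℓ t) = |s - t| * dist u u' := fun s t => by
    simp [ℓ, dist_lineMap_lineMap, Real.dist_eq]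
  have key : Set.Icc (0 : ℝ) 1 ⊆ {t | dist (f u) (f (ℓ t)) ≤ t * dist u u'} := by
    apply IsClosed.Icc_subset_of_forall_exists_gt
    · refine IsClosed.inter (isClosed_le ?_ ?_) isClosed_Icc
      · exact continuous_const.dist (hcont.comp hℓ)
      · fun_prop
    · simp [ℓ]
    · rintro t ⟨ht, ht0, ht1⟩ r hr
      have h1 := hℓ.continuousAt.eventually (hf (ℓ t))
      have h2 : ∀ᶠ s in nhdsWithin t (Set.Ioi t), s ∈ Set.Ioc t r := Ioc_mem_nhdsGT hr
      obtain ⟨s, hs, hs'⟩ := ((h1.filter_mono nhdsWithin_le_nhds).and h2).exists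
      refine ⟨s, ?_, hs'⟩
      simp only [Set.mem_ofPred_eq] at ht ⊢
      have h3 := dist_triangle (f u) (f (ℓ t)) (f (ℓ s))
      rw [hℓd, abs_of_nonpos (by linarith [hs'.1])] at hs
      linarith
  simpa [ℓ] using key (Set.right_mem_Icc.2 zero_le_one)

theorem dist_flat_le (i : Bool) (p : G) (u u' : Vec) :
    dist (flat i p u) (flat i p u') ≤ dist u u' :=
  dist_le_of_eventually (eventually_dist_flat_le i p) u u'

theorem dist_proj_le (i : Bool) (p : G) (x y : Cover triangleAndPoint) :
    dist (proj i p x) (proj i p y) ≤ dist x y := by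
  refine le_dist_of_forall_pathLength fun L h => ?_
  refine pathLength_induction (P := fun x y L => dist (proj i p x) (proj i p y) ≤ L)
    (fun x => by simp) ?_ h
  · intro j g u u' y L _ _ _ ih
    refine (dist_triangle _ (proj i p (flat j g u')) _).trans (add_le_add ?_ ih)
    by_cases h : j ≠ i ∨ ∀ k, g ≠ p * lattice i k
    · simp [proj_flat_of_disjoint i j p g h]
    · push Not at h
      obtain ⟨rfl, k, rfl⟩ := h
      rw [flat_mul_lattice, flat_mul_lattice, proj_flat, proj_flat]
      exact (dist_truncate_le _ _ _).trans (by simp)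

theorem dist_flat (i : Bool) (p : G) (u u' : Vec) :
    dist (flat i p u) (flat i p u') = dist (truncate i u) (truncate i u') := by
  refine le_antisymm ?_ ?_
  · rw [← flat_truncate, ← flat_truncate i p u']; exact dist_flat_le i p _ _
  · simpa [proj_flat] using dist_proj_le i p (flat i p u) (flat i p u')

@[simp] theorem truncate_proj (i : Bool) (p : G) (x : Cover triangleAndPoint) :
    truncate i (proj i p x) = proj i p x := by
  ext v; by_cases h : block v = i <;> simp [truncate_apply, proj, lead, restrict, h]

/-- A path between points with different projections passes through the projections. -/
theorem dist_gate (i : Bool) (p : G) {x y : Cover triangleAndPoint} (h : proj i p x ≠ proj i p y) :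
    dist x y = dist x (flat i p (proj i p x)) + dist (flat i p (proj i p x)) y := by
  refine le_antisymm (dist_triangle _ _ _) (le_dist_of_forall_pathLength fun L hL => ?_)
  refine pathLength_induction (P := fun x y L => proj i p x ≠ proj i p y →
      dist x (flat i p (proj i p x)) + dist (flat i p (proj i p x)) y ≤ L)
    (fun x h => (h rfl).elim) ?_ hL h
  · intro j g u u' y L _ _ hL ih h
    by_cases hj : j ≠ i ∨ ∀ k, g ≠ p * lattice i k
    · have hu := proj_flat_of_disjoint i j p g hj u
      have hu' := proj_flat_of_disjoint i j p g hj u'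
      rw [hu] at h ⊢
      rw [hu'] at ih
      have := dist_triangle (flat j g u) (flat j g u') (flat i p (intVec (lead i (p⁻¹ * g))))
      linarith [ih h, dist_flat_le j g u u']
    · push Not at hj
      obtain ⟨rfl, k, rfl⟩ := hj
      rw [flat_mul_lattice, flat_proj_flat, dist_self, zero_add, ← flat_mul_lattice]
      linarith [dist_triangle (flat j (p * lattice j k) u) (flat j (p * lattice j k) u') y,
        dist_flat_le j (p * lattice j k) u u', dist_le_of_pathLength hL]

theorem dist_gate_gate (i : Bool) (p : G) {x y : Cover triangleAndPoint}
    (h : proj i p x ≠ proj i p y) :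
    dist x y = dist x (flat i p (proj i p x)) + dist (proj i p x) (proj i p y) +
      dist (flat i p (proj i p y)) y := by
  have h1 : proj i p (flat i p (proj i p x)) = proj i p x := by rw [proj_flat, truncate_proj]
  rw [dist_gate i p h, dist_comm _ y, dist_gate i p (x := y) (y := flat i p (proj i p x))
    (by rw [h1]; exact h.symm), dist_flat, truncate_proj, truncate_proj,
    dist_comm y, dist_comm (proj i p y)]
  ring

/-- Projections to flats map geodesics to geodesics. -/
theorem wbtw_proj (i : Bool) (p : G) {x y z : Cover triangleAndPoint}
    (h : dist x z + dist z y = dist x y) : Wbtw ℝ (proj i p x) (proj i p z) (proj i p y) := by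
  rw [← dist_add_dist_eq_iff]
  refine le_antisymm ?_ (dist_triangle _ _ _)
  by_cases hxz : proj i p x = proj i p z
  · simp [hxz]
  by_cases hzy : proj i p z = proj i p y
  · simp [hzy]
  have hx := dist_gate_gate i p hxz
  have hy := dist_gate_gate i p hzy
  have h1 := dist_nonneg (x := flat i p (proj i p z)) (y := z)
  have h2 := dist_comm (flat i p (proj i p z)) z
  by_cases hxy : proj i p x = proj i p y
  · have := dist_triangle x (flat i p (proj i p x)) y
    have h3 : dist (flat i p (proj i p x)) y = dist (flat i p (proj i p y)) y := by rw [hxy]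
    have h4 : dist (proj i p x) (proj i p y) = 0 := by rw [hxy, dist_self]
    linarith
  · have := dist_gate_gate i p hxy
    linarith

theorem continuous_flat (i : Bool) (p : G) : Continuous (flat i p) :=
  (LipschitzWith.of_dist_le_mul (K := 1) fun x y => by simpa using dist_flat_le i p x y).continuous

/-! ### Hyperplanes and halfspaces -/

open scoped Classical in
theorem proj_apply (i : Bool) (p : G) (x : Cover triangleAndPoint) (v : Fin 4) :
    proj i p x v = lead i (p⁻¹ * x.base) v +
      if ∃ k, p⁻¹ * x.base = lattice i k then restrict i x.coord v else 0 := rfl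

open scoped Classical in
theorem proj_mul_lattice (i : Bool) (p : G) (k : Fin 4 → ℤ) (x : Cover triangleAndPoint) :
    proj i (p * lattice i k) x = proj i p x - truncate i (intVec k) := by
  have h1 : (p * lattice i k)⁻¹ * x.base = lattice i (-k) * (p⁻¹ * x.base) := by
    rw [lattice_neg, mul_inv_rev, mul_assoc]
  have h2 : (∃ l, (p * lattice i k)⁻¹ * x.base = lattice i l) ↔
      ∃ l, p⁻¹ * x.base = lattice i l := by
    rw [h1]
    constructor
    · rintro ⟨l, hl⟩
      refine ⟨k + l, ?_⟩
      rw [lattice_add, ← hl, lattice_neg, mul_inv_cancel_left]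
    · rintro ⟨l, hl⟩
      exact ⟨-k + l, by rw [lattice_add, hl]⟩
  ext v
  rw [PiLp.sub_apply, proj_apply, proj_apply]
  rw [if_congr h2 rfl rfl, congrArg (lead i) h1, lead_lattice_mul]
  by_cases h : block v = i
  · simp only [Pi.add_apply, restrict, h, if_true, truncate_apply, intVec_apply, Pi.neg_apply]
    push_cast; ring
  · simp [restrict, truncate_apply, h]

theorem proj_vertex_mul_lattice (i : Bool) (p : G) (k : Fin 4 → ℤ) :
    proj i p (vertex (p * lattice i k)) = truncate i (intVec k) := by
  rw [← flat_intVec, proj_flat]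

theorem proj_vertex (i : Bool) (p q : G) :
    proj i p (vertex q) = intVec (lead i (p⁻¹ * q)) := by
  ext v; simp [proj_apply, vertex, restrict]

/-- The direction of the edges dual to a hyperplane. -/
def Hyperplane.dir (h : Hyperplane triangleAndPoint) : Fin 4 :=
  Quot.lift (fun e => e.2) (fun _ _ h => h.1.symm) h

/-- The coordinate that cuts out a hyperplane: the projection to the flat or line of an edge dual to
the hyperplane, followed by the coordinate in the direction of the edge, with the edge
corresponding to `[0, 1]`. -/
def Hyperplane.level (h : Hyperplane triangleAndPoint) : Cover triangleAndPoint → ℝ :=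
  Quot.lift (fun e x => proj (block e.2) e.1 x e.2) (by
    rintro ⟨g, v⟩ ⟨g', v'⟩ ⟨h, w, hw, h'⟩
    obtain ⟨hvw, hb⟩ := adj_iff.1 hw
    dsimp only at h h' hvw hb ⊢
    subst h h'
    ext x
    rw [gen_eq_lattice, ← hb, proj_mul_lattice]
    simp [truncate_apply, hvw]) h

/-- The hyperplane dual to the edge from `p * v ^ n` to `p * v ^ (n + 1)`. -/
def wall (p : G) (v : Fin 4) (n : ℤ) : Hyperplane triangleAndPoint :=
  Quot.mk _ (p * gen triangleAndPoint v ^ n, v)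

theorem exists_eq_wall (h : Hyperplane triangleAndPoint) : ∃ g, h = wall g h.dir 0 := by
  obtain ⟨⟨g, v⟩, rfl⟩ := Quot.exists_rep h
  refine ⟨g, ?_⟩
  change _ = Quot.mk _ (g * gen triangleAndPoint v ^ (0 : ℤ), v)
  rw [zpow_zero, mul_one]

theorem gen_zpow_eq_lattice (v : Fin 4) (n : ℤ) :
    gen triangleAndPoint v ^ n = lattice (block v) (Pi.single v n) := by
  simp [lattice_single]

theorem level_wall (p : G) (v : Fin 4) (n : ℤ) (x : Cover triangleAndPoint) :
    (wall p v n).level x = proj (block v) p x v - n := by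
  change proj (block v) (p * gen triangleAndPoint v ^ n) x v = _
  rw [gen_zpow_eq_lattice, proj_mul_lattice]
  simp [truncate_apply]

theorem dist_level_le (h : Hyperplane triangleAndPoint) (x y : Cover triangleAndPoint) :
    |h.level x - h.level y| ≤ dist x y := by
  obtain ⟨g, hg⟩ := exists_eq_wall h
  rw [hg, level_wall, level_wall]
  refine le_trans ?_ (dist_proj_le (block h.dir) g x y)
  have := PiLp.norm_apply_le (proj (block h.dir) g x - proj (block h.dir) g y) h.dir
  rw [← dist_eq_norm] at this
  simpa using this

theorem continuous_level (h : Hyperplane triangleAndPoint) : Continuous h.level :=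
  (LipschitzWith.of_dist_le_mul (K := 1) fun x y => by
    simpa [Real.dist_eq] using dist_level_le h x y).continuous

theorem mk_mul_lattice (g : G) (v : Fin 4) (k : Fin 4 → ℤ) (hk : k v = 0) :
    (Quot.mk _ (g * lattice (block v) k, v) : Hyperplane triangleAndPoint) = Quot.mk _ (g, v) := by
  have h1 : ∀ (g : G) (w : Fin 4) (n : ℤ), triangleAndPoint.Adj v w →
      (Quot.mk _ (g * gen triangleAndPoint w ^ n, v) : Hyperplane triangleAndPoint) =
        Quot.mk _ (g, v) := by
    intro g w n hw
    have h2 : ∀ g : G, (Quot.mk _ (g * gen triangleAndPoint w, v) : Hyperplane triangleAndPoint) =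
        Quot.mk _ (g, v) := fun g => (Quot.sound ⟨rfl, w, hw, rfl⟩).symm
    induction n using Int.induction_on with
    | zero => simp
    | succ n ih => rw [zpow_add_one, ← mul_assoc, h2, ih]
    | pred n ih => rw [← h2, mul_assoc, ← zpow_add_one, sub_add_cancel, ih]
  have h2 : ∀ S : Finset (Fin 4), ∀ g : G, (Quot.mk _ (g * lattice (block v)
      (∑ w ∈ S, Pi.single w (k w)), v) : Hyperplane triangleAndPoint) = Quot.mk _ (g, v) := by
    intro S
    induction S using Finset.induction_on with
    | empty => simp
    | insert w S hw ih =>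
      intro g
      rw [Finset.sum_insert hw, lattice_add, ← mul_assoc, ih, lattice_single]
      split_ifs with hb
      · by_cases hvw : v = w
        · subst hvw; simp [hk]
        · exact h1 _ _ _ (adj_iff.2 ⟨hvw, hb.symm⟩)
      · simp
  simpa [Finset.univ_sum_single] using h2 Finset.univ g

theorem mem_carrier_iff (h : Hyperplane triangleAndPoint) (x : Cover triangleAndPoint) :
    x ∈ h.carrier ↔ h.level x = 1 / 2 := by
  constructor
  · rintro ⟨v, hv, rfl⟩
    change proj (block v) x.base x v = _
    have : ∃ k, (1 : G) = lattice (block v) k := ⟨0, by simp⟩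
    simpa [proj_apply, restrict, this] using hv
  · intro hx
    obtain ⟨⟨g, v⟩, rfl⟩ := Quot.exists_rep h
    change proj (block v) g x v = _ at hx
    rw [proj_apply] at hx
    split_ifs at hx with hk
    · obtain ⟨k, hk⟩ := hk
      simp only [hk, lead_lattice, restrict, if_true] at hx
      have h0 := x.nonneg v
      have h1 := x.lt_one v
      have hkv : k v = 0 := by
        have h2 : (k v : ℝ) < 1 := by linarith
        have h3 : (-1 : ℝ) < k v := by linarith
        have h2' : k v < 1 := by exact_mod_cast h2
        have h3' : -1 < k v := by exact_mod_cast h3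
        omega
      refine ⟨v, by simpa [hkv] using hx, ?_⟩
      rw [← mk_mul_lattice g v k hkv, ← hk, mul_inv_cancel_left]
    · have h2 : (2 * lead (block v) (g⁻¹ * x.base) v : ℝ) = 1 := by linarith
      have h2' : 2 * lead (block v) (g⁻¹ * x.base) v = 1 := by exact_mod_cast h2
      omega

/-- The fibres of the projection to a flat are connected: a path to the flat stays in the fibre
until it hits the flat. -/
theorem exists_isPreconnected_fiber (i : Bool) (p : G) (x : Cover triangleAndPoint) :
    ∃ C, IsPreconnected C ∧ x ∈ C ∧ flat i p (proj i p x) ∈ C ∧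
      ∀ y ∈ C, proj i p y = proj i p x := by
  obtain ⟨L, hL⟩ := exists_pathLength x (flat i p (proj i p x))
  refine pathLength_induction (P := fun x y L =>
    (proj i p y ≠ proj i p x ∨ y = flat i p (proj i p x)) → ∃ C, IsPreconnected C ∧ x ∈ C ∧
      flat i p (proj i p x) ∈ C ∧ ∀ y ∈ C, proj i p y = proj i p x) ?_ ?_ hL (Or.inr rfl)
  · rintro x (h | h)
    · exact (h rfl).elim
    · exact ⟨{x}, isPreconnected_singleton, rfl, h.symm, fun y hy => by rw [hy]⟩
  · intro j g u u' y L _ _ _ ih h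
    by_cases hj : j ≠ i ∨ ∀ k, g ≠ p * lattice i k
    · have hc := proj_flat_of_disjoint i j p g hj
      simp only [hc] at ih h ⊢
      obtain ⟨C, hC, h1, h2, h3⟩ := ih h
      refine ⟨C ∪ flat j g '' segment ℝ u u', ?_, Or.inr ⟨u, left_mem_segment _ _ _, rfl⟩,
        Or.inl h2, ?_⟩
      · exact hC.union _ h1 ⟨u', right_mem_segment _ _ _, rfl⟩
          ((convex_segment u u').isPreconnected.image _ (continuous_flat j g).continuousOn)
      · rintro y (hy | ⟨w, -, rfl⟩)
        · exact h3 y hy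
        · exact hc w
    · push Not at hj
      obtain ⟨rfl, k, rfl⟩ := hj
      refine ⟨{flat j (p * lattice j k) u}, isPreconnected_singleton, rfl, ?_,
        fun y hy => by rw [hy]⟩
      rw [flat_mul_lattice, flat_proj_flat]; rfl

theorem isPreconnected_level_preimage (h : Hyperplane triangleAndPoint) {S : Set ℝ}
    (hS : Convex ℝ S) : IsPreconnected (h.level ⁻¹' S) := by
  obtain ⟨⟨p, v⟩, rfl⟩ := Quot.exists_rep h
  change IsPreconnected {x | proj (block v) p x v ∈ S}
  refine isPreconnected_of_forall_pair fun x hx y hy => ?_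
  obtain ⟨C, hC, h1, h2, h3⟩ := exists_isPreconnected_fiber (block v) p x
  obtain ⟨D, hD, k1, k2, k3⟩ := exists_isPreconnected_fiber (block v) p y
  set u := proj (block v) p x
  set u' := proj (block v) p y
  have hE : IsPreconnected (flat (block v) p '' segment ℝ u u') :=
    (convex_segment u u').isPreconnected.image _ (continuous_flat _ p).continuousOn
  refine ⟨C ∪ flat (block v) p '' segment ℝ u u' ∪ D, ?_, Or.inl (Or.inl h1), Or.inr k1, ?_⟩
  rotate_left
  · have hCE := hC.union (flat (block v) p u) h2
      (Set.mem_image_of_mem _ (left_mem_segment ℝ u u')) hE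
    exact hCE.union (flat (block v) p u')
      (Or.inr (Set.mem_image_of_mem _ (right_mem_segment ℝ u u'))) k2 hD
  · rintro z ((hz | ⟨w, hw, rfl⟩) | hz)
    · simpa [h3 z hz] using hx
    · obtain ⟨s, t, hs, ht, hst, rfl⟩ := hw
      simp only [Set.mem_ofPred_eq, proj_flat, truncate_apply, if_true]
      exact hS hx hy hs ht hst
    · simpa [k3 z hz] using hy

theorem connectedComponentIn_of_level_lt (h : Hyperplane triangleAndPoint)
    {x : Cover triangleAndPoint} (hx : h.level x < 1 / 2) :
    connectedComponentIn h.carrierᶜ x = h.level ⁻¹' Set.Iio (1 / 2) := by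
  have hxc : x ∈ h.carrierᶜ := fun h' => hx.ne ((mem_carrier_iff h x).1 h')
  refine Set.Subset.antisymm (fun y hy => ?_) ?_
  · by_contra hy'
    have h1 := (isPreconnected_connectedComponentIn (x := x) (F := h.carrierᶜ)).image h.level
      (continuous_level h).continuousOn
    obtain ⟨z, hz, hz'⟩ := h1.ordConnected.out ⟨x, mem_connectedComponentIn hxc, rfl⟩ ⟨y, hy, rfl⟩
      ⟨hx.le, not_lt.1 hy'⟩
    exact connectedComponentIn_subset _ _ hz ((mem_carrier_iff h z).2 hz')
  · exact (isPreconnected_level_preimage h (convex_Iio _)).subset_connectedComponentIn hx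
      fun y hy h' => ne_of_lt hy ((mem_carrier_iff h y).1 h')

theorem connectedComponentIn_of_lt_level (h : Hyperplane triangleAndPoint)
    {x : Cover triangleAndPoint} (hx : 1 / 2 < h.level x) :
    connectedComponentIn h.carrierᶜ x = h.level ⁻¹' Set.Ioi (1 / 2) := by
  have hxc : x ∈ h.carrierᶜ := fun h' => hx.ne' ((mem_carrier_iff h x).1 h')
  refine Set.Subset.antisymm (fun y hy => ?_) ?_
  · by_contra hy'
    have h1 := (isPreconnected_connectedComponentIn (x := x) (F := h.carrierᶜ)).image h.level
      (continuous_level h).continuousOn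
    obtain ⟨z, hz, hz'⟩ := h1.ordConnected.out ⟨y, hy, rfl⟩ ⟨x, mem_connectedComponentIn hxc, rfl⟩
      ⟨not_lt.1 hy', hx.le⟩
    exact connectedComponentIn_subset _ _ hz ((mem_carrier_iff h z).2 hz')
  · exact (isPreconnected_level_preimage h (convex_Ioi _)).subset_connectedComponentIn hx
      fun y hy h' => ne_of_gt hy ((mem_carrier_iff h y).1 h')

/-- The halfspaces bounded by a hyperplane are the two sides of the level `1 / 2`. -/
theorem separates_iff (h : Hyperplane triangleAndPoint) {A B : Set (Cover triangleAndPoint)}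
    (hA : A.Nonempty) (hB : B.Nonempty) : h.Separates A B ↔
      ((∀ x ∈ A, h.level x < 1 / 2) ∧ ∀ y ∈ B, 1 / 2 < h.level y) ∨
      ((∀ x ∈ A, 1 / 2 < h.level x) ∧ ∀ y ∈ B, h.level y < 1 / 2) := by
  constructor
  · rintro ⟨_, _, ⟨p, hp, rfl⟩, ⟨q, hq, rfl⟩, hne, hAp, hBq⟩
    rw [Set.mem_compl_iff, mem_carrier_iff] at hp hq
    rcases lt_or_gt_of_ne hp with hp | hp <;> rcases lt_or_gt_of_ne hq with hq | hq
    · rw [connectedComponentIn_of_level_lt h hp, connectedComponentIn_of_level_lt h hq] at hne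
      exact (hne rfl).elim
    · rw [connectedComponentIn_of_level_lt h hp] at hAp
      rw [connectedComponentIn_of_lt_level h hq] at hBq
      exact Or.inl ⟨hAp, hBq⟩
    · rw [connectedComponentIn_of_lt_level h hp] at hAp
      rw [connectedComponentIn_of_level_lt h hq] at hBq
      exact Or.inr ⟨hAp, hBq⟩
    · rw [connectedComponentIn_of_lt_level h hp, connectedComponentIn_of_lt_level h hq] at hne
      exact (hne rfl).elim
  · obtain ⟨p, hp⟩ := hA
    obtain ⟨q, hq⟩ := hB
    rintro (⟨hA, hB⟩ | ⟨hA, hB⟩)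
    · have h1 := connectedComponentIn_of_level_lt h (hA p hp)
      have h2 := connectedComponentIn_of_lt_level h (hB q hq)
      refine ⟨_, _, ⟨p, fun h' => (hA p hp).ne ((mem_carrier_iff h p).1 h'), rfl⟩,
        ⟨q, fun h' => (hB q hq).ne' ((mem_carrier_iff h q).1 h'), rfl⟩, ?_, ?_, ?_⟩
      · rw [h1, h2]
        intro h3
        have h4 : p ∈ h.level ⁻¹' Set.Ioi (1 / 2) := h3 ▸ hA p hp
        exact lt_asymm (hA p hp) h4
      · rw [h1]; exact hA
      · rw [h2]; exact hB
    · have h1 := connectedComponentIn_of_lt_level h (hA p hp)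
      have h2 := connectedComponentIn_of_level_lt h (hB q hq)
      refine ⟨_, _, ⟨p, fun h' => (hA p hp).ne' ((mem_carrier_iff h p).1 h'), rfl⟩,
        ⟨q, fun h' => (hB q hq).ne ((mem_carrier_iff h q).1 h'), rfl⟩, ?_, ?_, ?_⟩
      · rw [h1, h2]
        intro h3
        have h4 : p ∈ h.level ⁻¹' Set.Iio (1 / 2) := h3 ▸ hA p hp
        exact lt_asymm (hA p hp) h4
      · rw [h1]; exact hA
      · rw [h2]; exact hB

theorem separates_singleton_iff (h : Hyperplane triangleAndPoint) {x y : Cover triangleAndPoint} :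
    h.Separates {x} {y} ↔ (h.level x < 1 / 2 ∧ 1 / 2 < h.level y) ∨
      (1 / 2 < h.level x ∧ h.level y < 1 / 2) := by
  rw [separates_iff h (Set.singleton_nonempty _) (Set.singleton_nonempty _)]; simp

/-- The hyperplanes that separate a vertex from another vertex of a flat through it are dual to
edges on the coordinate lines through the first vertex. -/
theorem separates_vertex_mul_lattice_iff (h : Hyperplane triangleAndPoint) (i : Bool) (x : G)
    (w : Fin 4 → ℤ) : h.Separates {vertex x} {vertex (x * lattice i w)} ↔
      ∃ v n, block v = i ∧ h = wall x v n ∧ (0 ≤ n ∧ n < w v ∨ w v ≤ n ∧ n < 0) := by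
  rw [separates_singleton_iff]
  constructor
  · intro hs
    obtain ⟨⟨g, v⟩, rfl⟩ := Quot.exists_rep h
    change (proj (block v) g _ v < _ ∧ _ < proj (block v) g _ v) ∨
      (_ < proj (block v) g _ v ∧ proj (block v) g _ v < _) at hs
    simp only [proj_vertex, intVec_apply, ← mul_assoc] at hs
    by_cases hj : i ≠ block v ∨ ∀ k, g⁻¹ * x ≠ lattice (block v) k
    · rw [lead_mul_lattice _ _ _ _ hj] at hs
      rcases hs with hs | hs <;> linarith
    · push Not at hj
      obtain ⟨rfl, k, hk⟩ := hj
      simp only [hk, ← lattice_add, lead_lattice, restrict, if_true, Pi.add_apply] at hs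
      refine ⟨v, -k v, rfl, ?_, ?_⟩
      · rw [wall, gen_zpow_eq_lattice, ← mul_inv_cancel_left g x, hk, mul_assoc, ← lattice_add,
          mk_mul_lattice]
        simp
      · rcases hs with ⟨h1, h2⟩ | ⟨h1, h2⟩
        · left
          have h3 : (k v : ℝ) < 1 := by linarith
          have h4 : (0 : ℝ) < (k v + w v : ℤ) := by linarith
          have h3' : k v < 1 := by exact_mod_cast h3
          have h4' : 0 < k v + w v := by exact_mod_cast h4
          omega
        · right
          have h3 : (0 : ℝ) < k v := by linarith
          have h4 : ((k v + w v : ℤ) : ℝ) < 1 := by linarith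
          have h3' : 0 < k v := by exact_mod_cast h3
          have h4' : k v + w v < 1 := by exact_mod_cast h4
          omega
  · rintro ⟨v, n, rfl, rfl, hn⟩
    rw [level_wall, level_wall, proj_vertex_mul_lattice, proj_vertex]
    simp only [inv_mul_cancel, lead_one, intVec_apply, truncate_apply, if_true, Pi.zero_apply,
      Int.cast_zero, zero_sub]
    rcases hn with ⟨h1, h2⟩ | ⟨h1, h2⟩
    · left
      have h1' : (0 : ℝ) ≤ n := by exact_mod_cast h1
      have h2' : (n : ℝ) + 1 ≤ w v := by exact_mod_cast h2
      constructor <;> linarith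
    · right
      have h1' : (w v : ℝ) ≤ n := by exact_mod_cast h1
      have h2' : (n : ℝ) + 1 ≤ 0 := by exact_mod_cast h2
      constructor <;> linarith

/-! ### The Morse boundary points at the ends of the `d`-lines -/

/-- The point at time `t` of the line of `d`-edges through the vertex `q`. -/
def line (q : G) (t : ℝ) : Cover triangleAndPoint := flat true q (EuclideanSpace.single 3 t)

theorem truncate_single (t : ℝ) :
    truncate true (EuclideanSpace.single 3 t) = EuclideanSpace.single 3 t := by
  ext v; fin_cases v <;> simp [truncate_apply, block]

theorem dist_line (q : G) (s t : ℝ) : dist (line q s) (line q t) = |s - t| := by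
  rw [line, line, dist_flat, truncate_single, truncate_single]
  simp [Real.dist_eq]

theorem line_natCast (q : G) (n : ℕ) : line q n = vertex (q * d ^ n) := by
  have : (EuclideanSpace.single 3 (n : ℝ) : Vec) = intVec (Pi.single 3 n) := by
    ext v; by_cases h : v = 3
    · subst h; simp
    · simp [h]
  rw [line, this, flat_intVec, lattice_single]
  simp [block]

theorem line_zero (q : G) : line q 0 = vertex q := by simpa using line_natCast q 0

/-- The coordinate of the projection to the line of `d`-edges through `q`. -/
def lineCoord (q : G) (x : Cover triangleAndPoint) : ℝ := proj true q x 3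

theorem flat_proj_eq_line (q : G) (x : Cover triangleAndPoint) :
    flat true q (proj true q x) = line q (lineCoord q x) := by
  rw [line, ← truncate_proj]
  congr 1
  ext v; rw [truncate_apply]; fin_cases v <;> simp [block, lineCoord]

theorem lineCoord_line (q : G) (t : ℝ) : lineCoord q (line q t) = t := by
  simp [lineCoord, line, proj_flat, truncate_single]

theorem proj_ne_of_lineCoord_ne {q : G} {x y : Cover triangleAndPoint}
    (h : lineCoord q x ≠ lineCoord q y) : proj true q x ≠ proj true q y := fun h' => h (by
  rw [lineCoord, lineCoord, h'])

/-- A path between points with different projections to the line passes through the projections. -/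
theorem dist_eq_add_line {q : G} {x y : Cover triangleAndPoint}
    (h : lineCoord q x ≠ lineCoord q y) :
    dist x y = dist x (line q (lineCoord q x)) + dist (line q (lineCoord q x)) y := by
  rw [← flat_proj_eq_line]; exact dist_gate true q (proj_ne_of_lineCoord_ne h)

theorem abs_lineCoord_sub_le (q : G) (x y : Cover triangleAndPoint) :
    |lineCoord q x - lineCoord q y| ≤ dist x y := by
  rw [← dist_line q, ← flat_proj_eq_line, ← flat_proj_eq_line, dist_flat, truncate_proj,
    truncate_proj]
  exact dist_proj_le _ _ _ _

theorem continuous_lineCoord (q : G) : Continuous (lineCoord q) :=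
  (LipschitzWith.of_dist_le_mul (K := 1) fun x y => by
    simpa [Real.dist_eq] using abs_lineCoord_sub_le q x y).continuous

/-- A coarse path that ends in `P` gets close to the gate `v` of `P`: it starts at `v` or enters `P`
near `v`. -/
theorem exists_dist_gate_le {Y : Type*} [PseudoMetricSpace Y] {β : ℝ → Y} {a t D : ℝ} (hat : a ≤ t)
    (hD : 0 ≤ D)
    (hβ : ∀ s ∈ Set.Icc a t, ∀ s' ∈ Set.Icc a t, |s - s'| ≤ 1 → dist (β s) (β s') ≤ D)
    {P : Set Y} {v : Y} (hP : ∀ x ∈ P, ∀ y ∉ P, dist x v ≤ dist x y) (ha : β a ∈ P → β a = v)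
    (ht : β t ∈ P) : ∃ s ∈ Set.Icc a t, dist (β s) v ≤ D := by
  let T : Set ℝ := {s | s ∈ Set.Icc a t ∧ β s ∉ P}
  by_cases hT : T.Nonempty
  · have hbdd : BddAbove T := ⟨t, fun s hs => hs.1.2⟩
    obtain ⟨s₂, hs₂, hlt⟩ := exists_lt_of_lt_csSup hT (show sSup T - 1 / 2 < sSup T by linarith)
    have hle : s₂ ≤ sSup T := le_csSup hbdd hs₂
    have hsup : sSup T ≤ t := csSup_le hT fun s hs => hs.1.2
    have h₁ : min (sSup T + 1 / 2) t ∈ Set.Icc a t :=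
      ⟨le_min (by linarith [hs₂.1.1]) hat, min_le_right _ _⟩
    have hmem : β (min (sSup T + 1 / 2) t) ∈ P := by
      rcases le_total (sSup T + 1 / 2) t with h | h
      · by_contra hn
        have := le_csSup hbdd (show min (sSup T + 1 / 2) t ∈ T from ⟨h₁, hn⟩)
        rw [min_eq_left h] at this
        linarith
      · rwa [min_eq_right h]
    refine ⟨_, h₁, (hP _ hmem _ hs₂.2).trans (hβ _ h₁ _ hs₂.1 ?_)⟩
    rw [abs_le]
    constructor
    · have : sSup T ≤ min (sSup T + 1 / 2) t := le_min (by linarith) hsup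
      linarith
    · linarith [min_le_left (sSup T + 1 / 2) t]
  · have ha' : β a ∈ P := by
      by_contra hn
      exact hT ⟨a, Set.left_mem_Icc.2 hat, hn⟩
    exact ⟨a, Set.left_mem_Icc.2 hat, by rw [ha ha', dist_self]; exact hD⟩

/-- A set is Morse if every point is separated from it by a cut point `v` that belongs to it: a
quasi-geodesic with endpoints in the set passes near `v` before and after it visits the point. -/
theorem isMorse_of_gates {Y : Type*} [PseudoMetricSpace Y] {S : Set Y}
    (h : ∀ x, ∃ P : Set Y, ∃ v ∈ S, x ∈ P ∧ (∀ x ∈ P, ∀ y ∉ P, dist x v ≤ dist x y) ∧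
      ∀ x ∈ S, x ∈ P → x = v) : IsMorse S := by
  refine ⟨fun K C => K * (K * (2 * (K + C) + C)) + C + (K + C), ?_⟩
  intro K C hK hC a b β hab hβ ha hb t ht
  obtain ⟨P, v, hv, hxP, hP, hS⟩ := h (β t)
  refine ⟨v, hv, ?_⟩
  have hK0 : 0 < K := by linarith
  have hstep : ∀ s ∈ Set.Icc a b, ∀ s' ∈ Set.Icc a b, |s - s'| ≤ 1 → dist (β s) (β s') ≤ K + C := by
    intro s hs s' hs' h1
    refine (hβ s hs s' hs').2.trans ?_
    rw [Real.dist_eq]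
    nlinarith
  obtain ⟨s, hs, hsv⟩ := exists_dist_gate_le ht.1 (by linarith) (fun s hs s' hs' =>
    hstep s ⟨hs.1, hs.2.trans ht.2⟩ s' ⟨hs'.1, hs'.2.trans ht.2⟩) hP (hS _ ha) hxP
  obtain ⟨s', hs', hsv'⟩ := exists_dist_gate_le (β := fun r => β (-r)) (a := -b) (t := -t)
    (by linarith [ht.2]) (show 0 ≤ K + C by linarith) (fun s hs s' hs' h1 => by
      refine hstep _ ⟨by linarith [ht.1, hs.2], by linarith [hs.1]⟩ _
        ⟨by linarith [ht.1, hs'.2], by linarith [hs'.1]⟩ ?_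
      rwa [neg_sub_neg, abs_sub_comm]) hP (by simpa using hS _ hb) (by simpa using hxP)
  have hsI : s ∈ Set.Icc a b := ⟨hs.1, hs.2.trans ht.2⟩
  have hsI' : -s' ∈ Set.Icc a b := ⟨by linarith [ht.1, hs'.2], by linarith [hs'.1]⟩
  have h1 : dist (β s) (β (-s')) ≤ 2 * (K + C) := by
    have := dist_triangle_right (β s) (β (-s')) v
    linarith
  have h2 := (hβ s hsI (-s') hsI').1
  have h3 : dist s (-s') ≤ K * (2 * (K + C) + C) := by
    have h4 : K⁻¹ * dist s (-s') ≤ 2 * (K + C) + C := by linarith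
    rwa [inv_mul_le_iff₀ hK0] at h4
  have h5 : dist t s ≤ dist s (-s') := by
    rw [Real.dist_eq, Real.dist_eq, abs_of_nonneg (by linarith [hs.2]),
      abs_of_nonpos (by linarith [hs.2, hs'.2])]
    linarith [hs'.2]
  have h6 := (hβ t ht s hsI).2
  have h7 := dist_triangle (β t) (β s) v
  have h8 : K * dist t s ≤ K * (K * (2 * (K + C) + C)) :=
    mul_le_mul_of_nonneg_left (h5.trans h3) hK0.le
  linarith

theorem isMorse_range_line (q : G) : IsMorse (Set.range fun t : ℝ≥0 => line q t) := by
  refine isMorse_of_gates fun x => ?_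
  rcases le_or_gt 0 (lineCoord q x) with hx | hx
  · refine ⟨{y | lineCoord q y = lineCoord q x}, line q (lineCoord q x),
      ⟨⟨_, hx⟩, rfl⟩, rfl, fun y hy z hz => ?_, ?_⟩
    · have hy : lineCoord q y = lineCoord q x := hy
      have hz : lineCoord q z ≠ lineCoord q x := hz
      have := dist_eq_add_line (q := q) (x := y) (y := z) (by rw [hy]; exact hz.symm)
      rw [this, ← hy]
      linarith [dist_nonneg (x := line q (lineCoord q y)) (y := z)]
    · rintro _ ⟨t, rfl⟩ ht
      have ht : lineCoord q (line q t) = lineCoord q x := ht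
      rw [← ht, lineCoord_line]
  · refine ⟨{y | lineCoord q y < 0}, line q 0, ⟨0, by simp⟩, hx, fun y hy z hz => ?_, ?_⟩
    · have hy : lineCoord q y < 0 := hy
      have hz : 0 ≤ lineCoord q z := not_lt.1 hz
      have h1 := dist_eq_add_line (q := q) (x := y) (y := z) (hy.trans_le hz).ne
      have h2 := dist_triangle y (line q (lineCoord q y)) (line q 0)
      have h3 := abs_lineCoord_sub_le q (line q (lineCoord q y)) z
      rw [dist_line, sub_zero, abs_of_neg hy] at h2
      rw [lineCoord_line, abs_of_nonpos (by linarith)] at h3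
      linarith
    · rintro _ ⟨t, rfl⟩ ht
      have ht : lineCoord q (line q t) < 0 := ht
      rw [lineCoord_line] at ht
      exact absurd t.2 (not_le.2 ht)

theorem isQuasiGeodesicOn_of_dist_line_le {γ : ℝ≥0 → Cover triangleAndPoint} {q : G} {C : ℝ}
    (h : ∀ t, dist (γ t) (line q t) ≤ C) : IsQuasiGeodesicOn 1 (2 * C) γ Set.univ := by
  intro s _ t _
  have h1 := dist_triangle4 (γ s) (line q s) (line q t) (γ t)
  have h2 := dist_triangle4 (line q s) (γ s) (γ t) (line q t)
  rw [dist_line] at h1 h2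
  rw [dist_comm (line q s) (γ s)] at h2
  rw [dist_comm (line q t) (γ t)] at h1
  rw [NNReal.dist_eq]
  have hs := h s
  have ht := h t
  constructor <;> linarith

/-- A path at bounded distance from a line, as a quasi-geodesic ray. -/
def rayOfDistLine (γ : ℝ≥0 → Cover triangleAndPoint) (q : G)
    (h : ∃ C, ∀ t, dist (γ t) (line q t) ≤ C) : QuasiGeodesicRay (Cover triangleAndPoint) :=
  ⟨γ, 1, 2 * h.choose, le_rfl, by linarith [dist_nonneg.trans (h.choose_spec 0)],
    isQuasiGeodesicOn_of_dist_line_le h.choose_spec⟩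

/-- The ray of `d`-edges starting at the vertex `q`. -/
def lineRay (q : G) : QuasiGeodesicRay (Cover triangleAndPoint) :=
  rayOfDistLine (fun t => line q t) q ⟨0, fun t => by simp⟩

/-- The point of the Morse boundary represented by the ray of `d`-edges starting at `q`. -/
def boundaryPoint (q : G) : Bdry :=
  ⟨Quotient.mk _ (lineRay q), lineRay q, rfl, isMorse_range_line q⟩

theorem mk_rayOfDistLine (γ : ℝ≥0 → Cover triangleAndPoint) (q : G)
    (h : ∃ C, ∀ t, dist (γ t) (line q t) ≤ C) :
    Quotient.mk (asymptotic (Cover triangleAndPoint)) (rayOfDistLine γ q h) =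
      (boundaryPoint q).1 := by
  obtain ⟨C, hC⟩ := h
  refine Quotient.sound (s := asymptotic (Cover triangleAndPoint)) ?_
  change Metric.hausdorffEDist (Set.range γ) (Set.range fun t : ℝ≥0 => line q t) ≠ ⊤
  have hle : Metric.hausdorffEDist (Set.range γ) (Set.range fun t : ℝ≥0 => line q t) ≤
      ENNReal.ofReal C := by
    refine Metric.hausdorffEDist_le_of_mem_edist ?_ ?_
    · rintro _ ⟨t, rfl⟩
      refine ⟨_, ⟨t, rfl⟩, ?_⟩
      rw [edist_dist]
      exact ENNReal.ofReal_le_ofReal (hC t)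
    · rintro _ ⟨t, rfl⟩
      refine ⟨_, ⟨t, rfl⟩, ?_⟩
      rw [edist_dist, dist_comm]
      exact ENNReal.ofReal_le_ofReal (hC t)
  exact ne_top_of_le_ne_top ENNReal.ofReal_ne_top hle

theorem prod_take_eventually (l : List G) (g : G) (n : ℕ) :
    ((eventually l g).take n).prod = (l.take n).prod * g ^ (n - l.length) := by
  induction l generalizing n with
  | nil =>
    have : (Stream'.const g).take n = List.replicate n g := by
      induction n with
      | zero => rfl
      | succ n ih => rw [Stream'.take_succ, Stream'.tail_const, ih]; rfl
    change ((Stream'.const g).take n).prod = _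
    simp [this]
  | cons x l ih =>
    cases n with
    | zero => simp [Stream'.take]
    | succ n =>
      change (x :: (eventually l g).take n).prod = _
      simp [ih, mul_assoc]

theorem represents_boundaryPoint (o : G) (l : List G) :
    Represents o (eventually l d) (boundaryPoint (o * l.prod)) := by
  have h : ∃ C, ∀ t : ℝ≥0, dist (vertex (o * ((eventually l d).take ⌊t⌋₊).prod))
      (line (o * l.prod) t) ≤ C := by
    have hM : ∀ n : ℕ, dist (vertex (o * (l.take n).prod) : Cover triangleAndPoint)
        (vertex (o * l.prod)) ≤ ∑ m ∈ Finset.range l.length,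
          dist (vertex (o * (l.take m).prod) : Cover triangleAndPoint) (vertex (o * l.prod)) := by
      intro n
      rcases lt_or_ge n l.length with hn | hn
      · exact Finset.single_le_sum (f := fun m =>
          dist (vertex (o * (l.take m).prod) : Cover triangleAndPoint) (vertex (o * l.prod)))
          (fun _ _ => dist_nonneg) (Finset.mem_range.2 hn)
      · rw [List.take_of_length_le hn, dist_self]
        exact Finset.sum_nonneg fun _ _ => dist_nonneg
    refine ⟨∑ m ∈ Finset.range l.length,
      dist (vertex (o * (l.take m).prod) : Cover triangleAndPoint) (vertex (o * l.prod)) +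
        l.length + 1, fun t => ?_⟩
    have ht := Nat.floor_le t.2
    have ht' := Nat.lt_floor_add_one (t : ℝ)
    rw [prod_take_eventually]
    set n := ⌊t⌋₊ with hn
    have hn' : ⌊(t : ℝ)⌋₊ = n := rfl
    rw [hn'] at ht'
    have ht : (n : ℝ) ≤ t := ht
    rcases lt_or_ge n l.length with hlt | hge
    · rw [Nat.sub_eq_zero_of_le hlt.le, pow_zero, mul_one]
      refine (dist_triangle _ (vertex (o * l.prod)) _).trans ?_
      rw [← line_zero (o * l.prod), dist_line, zero_sub, abs_neg, NNReal.abs_eq, line_zero]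
      have : (n : ℝ) + 1 ≤ l.length := by exact_mod_cast hlt
      linarith [hM n]
    · rw [List.take_of_length_le hge, ← mul_assoc, ← line_natCast, dist_line, Nat.cast_sub hge]
      have h0 : 0 ≤ ∑ m ∈ Finset.range l.length,
          dist (vertex (o * (l.take m).prod) : Cover triangleAndPoint) (vertex (o * l.prod)) :=
        Finset.sum_nonneg fun _ _ => dist_nonneg
      rw [abs_le]
      constructor <;> linarith [(Nat.cast_nonneg l.length : (0 : ℝ) ≤ _)]
  exact ⟨rayOfDistLine _ _ h, mk_rayOfDistLine _ _ h, rfl⟩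

/-! ### Geodesic rays -/

theorem truncate_smul (i : Bool) (r : ℝ) (u : Vec) : truncate i (r • u) = r • truncate i u := by
  ext v; by_cases h : block v = i <;> simp [truncate_apply, h]

/-- The straight segment in the flat from `p` to `q = p * lattice false k`, followed by the ray of
`d`-edges starting at `q`. -/
def bentRay (p : G) (k : Fin 4 → ℤ) (t : ℝ≥0) : Cover triangleAndPoint :=
  if (t : ℝ) ≤ ‖truncate false (intVec k)‖ then
    flat false p ((t / ‖truncate false (intVec k)‖) • truncate false (intVec k))
  else line (p * lattice false k) (t - ‖truncate false (intVec k)‖)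

theorem bentRay_nnnorm (p : G) (k : Fin 4 → ℤ) :
    bentRay p k ‖truncate false (intVec k)‖₊ = vertex (p * lattice false k) := by
  have h1 : (‖truncate false (intVec k)‖ / ‖truncate false (intVec k)‖) •
      truncate false (intVec k) = truncate false (intVec k) := by
    rcases (norm_nonneg (truncate false (intVec k))).eq_or_lt with h | h
    · rw [norm_eq_zero.1 h.symm, smul_zero]
    · rw [div_self h.ne', one_smul]
  rw [bentRay, coe_nnnorm, if_pos le_rfl, h1, flat_truncate, flat_intVec]

theorem lineCoord_flat_false (p : G) (k : Fin 4 → ℤ) (u : Vec) :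
    lineCoord (p * lattice false k) (flat false p u) = 0 := by
  rw [lineCoord, proj_flat_of_disjoint true false _ _ (Or.inl (by simp)), mul_inv_rev,
    inv_mul_cancel_right, ← lattice_neg, lead_lattice_of_ne (by simp)]
  simp

theorem isometry_bentRay (p : G) (k : Fin 4 → ℤ) : Isometry (bentRay p k) := by
  set u := truncate false (intVec k) with hu
  have hℓ : 0 ≤ ‖u‖ := norm_nonneg u
  have hflat : ∀ s t : ℝ≥0, (s : ℝ) ≤ ‖u‖ → (t : ℝ) ≤ ‖u‖ →
      dist (flat false p (((s : ℝ) / ‖u‖) • u)) (flat false p (((t : ℝ) / ‖u‖) • u)) =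
        |(s : ℝ) - t| := by
    intro s t hs ht
    rw [dist_flat, truncate_smul, truncate_smul, hu, truncate_truncate, ← hu, dist_eq_norm,
      ← sub_smul, norm_smul, ← sub_div, Real.norm_eq_abs, abs_div, abs_norm]
    rcases hℓ.eq_or_lt with h | h
    · have hs0 : (s : ℝ) = 0 := le_antisymm (h ▸ hs) s.2
      have ht0 : (t : ℝ) = 0 := le_antisymm (h ▸ ht) t.2
      simp [hs0, ht0]
    · field_simp
  have hend : ∀ s : ℝ≥0, (s : ℝ) ≤ ‖u‖ →
      dist (flat false p (((s : ℝ) / ‖u‖) • u)) (line (p * lattice false k) 0) = ‖u‖ - s := by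
    intro s hs
    have := hflat s ‖u‖₊ hs le_rfl
    have hb := bentRay_nnnorm p k
    rw [bentRay, ← hu, coe_nnnorm, if_pos le_rfl] at hb
    rw [coe_nnnorm, hb, abs_of_nonpos (by linarith)] at this
    rw [line_zero, this]
    ring
  refine Isometry.of_dist_eq fun s t => ?_
  wlog hst : s ≤ t generalizing s t
  · rw [dist_comm, this t s (le_of_not_ge hst), dist_comm]
  have hst' : (s : ℝ) ≤ t := hst
  rw [NNReal.dist_eq]
  unfold bentRay
  rw [← hu]
  by_cases ht : (t : ℝ) ≤ ‖u‖
  · rw [if_pos (hst'.trans ht), if_pos ht]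
    exact hflat s t (hst'.trans ht) ht
  · rw [if_neg ht]
    push Not at ht
    by_cases hs : (s : ℝ) ≤ ‖u‖
    · rw [if_pos hs, dist_eq_add_line (q := p * lattice false k)
        (by rw [hu, lineCoord_flat_false, lineCoord_line]; linarith), lineCoord_flat_false,
        hend s hs, dist_line, abs_of_nonpos (by linarith), abs_of_nonpos (by linarith)]
      ring
    · rw [if_neg hs, dist_line]
      congr 1; ring

theorem dist_bentRay_line_le (p : G) (k : Fin 4 → ℤ) (t : ℝ≥0) :
    dist (bentRay p k t) (line (p * lattice false k) t) ≤ 2 * ‖truncate false (intVec k)‖ := by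
  have hℓ := norm_nonneg (truncate false (intVec k))
  rcases le_or_gt (t : ℝ) ‖truncate false (intVec k)‖ with ht | ht
  · have h1 := dist_triangle (bentRay p k t) (bentRay p k ‖truncate false (intVec k)‖₊)
      (line (p * lattice false k) t)
    rw [(isometry_bentRay p k).dist_eq, bentRay_nnnorm, ← line_zero, dist_line, NNReal.dist_eq,
      coe_nnnorm, abs_of_nonpos (by linarith), zero_sub, abs_neg, NNReal.abs_eq] at h1
    linarith
  · rw [bentRay, if_neg (not_le.2 ht), dist_line, abs_of_nonpos (by linarith)]
    linarith

theorem isGeodesicRep_bentRay (p : G) (k : Fin 4 → ℤ) :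
    IsGeodesicRep (vertex p) (boundaryPoint (p * lattice false k)) (bentRay p k) := by
  have h : ∃ C, ∀ t : ℝ≥0, dist (bentRay p k t) (line (p * lattice false k) t) ≤ C :=
    ⟨_, dist_bentRay_line_le p k⟩
  refine ⟨isometry_bentRay p k, ?_, rayOfDistLine _ _ h, rfl, mk_rayOfDistLine _ _ h⟩
  rw [bentRay, if_pos (by simp)]
  simp [flat_zero]

/-! ### The hyperplanes crossed by geodesic rays -/

theorem level_wall_vertex (p : G) (v : Fin 4) (n : ℤ) (q : G) :
    (wall p v n).level (vertex q) = ((lead (block v) (p⁻¹ * q) v - n : ℤ) : ℝ) := by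
  rw [level_wall, proj_vertex]; simp

theorem exists_level_vertex_eq (h : Hyperplane triangleAndPoint) (q : G) :
    ∃ n : ℤ, h.level (vertex q) = n := by
  obtain ⟨g, hg⟩ := exists_eq_wall h
  rw [hg]
  exact ⟨_, level_wall_vertex _ _ _ _⟩

theorem level_vertex_le_or_ge (h : Hyperplane triangleAndPoint) (q : G) :
    h.level (vertex q) ≤ 0 ∨ 1 ≤ h.level (vertex q) := by
  obtain ⟨n, hn⟩ := exists_level_vertex_eq h q
  rw [hn]
  rcases lt_or_ge 0 n with h | h
  · exact Or.inr (by exact_mod_cast h)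
  · exact Or.inl (by exact_mod_cast h)

/-- Levels do not leave the interval between their values at the endpoints of a geodesic. -/
theorem level_between (h : Hyperplane triangleAndPoint) {x y z : Cover triangleAndPoint}
    (hxyz : dist x z + dist z y = dist x y) :
    ∃ r ∈ Set.Icc (0 : ℝ) 1, h.level z = (1 - r) * h.level x + r * h.level y := by
  obtain ⟨g, hg⟩ := exists_eq_wall h
  obtain ⟨r, hr, hz⟩ := wbtw_proj (block h.dir) g hxyz
  refine ⟨r, hr, ?_⟩
  have := congrArg (fun u : Vec => u h.dir) hz
  simp only [AffineMap.lineMap_apply_module, PiLp.add_apply, PiLp.smul_apply, smul_eq_mul] at this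
  rw [hg, level_wall, level_wall, level_wall, ← this]
  simp

theorem level_lt_of_between (h : Hyperplane triangleAndPoint) {x y z : Cover triangleAndPoint}
    {c : ℝ} (hxyz : dist x z + dist z y = dist x y) (hx : h.level x < c) (hy : h.level y < c) :
    h.level z < c := by
  obtain ⟨r, ⟨h0, h1⟩, hz⟩ := level_between h hxyz
  rw [hz]
  exact convex_Iio c hx hy (by linarith) h0 (by ring)

theorem lt_level_of_between (h : Hyperplane triangleAndPoint) {x y z : Cover triangleAndPoint}
    {c : ℝ} (hxyz : dist x z + dist z y = dist x y) (hx : c < h.level x) (hy : c < h.level y) :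
    c < h.level z := by
  obtain ⟨r, ⟨h0, h1⟩, hz⟩ := level_between h hxyz
  rw [hz]
  exact convex_Ioi c hx hy (by linarith) h0 (by ring)

theorem lineCoord_eq_level (q : G) : lineCoord q = (wall q 3 0).level := by
  ext x; rw [level_wall]; simp [lineCoord, block]

theorem dist_add_dist_of_isometry {Y : Type*} [PseudoMetricSpace Y] {γ : ℝ≥0 → Y} (hγ : Isometry γ)
    {s t : ℝ≥0} (h : s ≤ t) : dist (γ 0) (γ s) + dist (γ s) (γ t) = dist (γ 0) (γ t) := by
  have h' : (s : ℝ) ≤ t := h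
  simp only [hγ.dist_eq, NNReal.dist_eq, NNReal.coe_zero, zero_sub, abs_neg, NNReal.abs_eq]
  rw [abs_of_nonpos (by linarith)]
  ring

theorem lineCoord_vertex (p : G) (k : Fin 4 → ℤ) :
    lineCoord (p * lattice false k) (vertex p) = 0 := by
  rw [← flat_zero false, lineCoord_flat_false]

/-- Every geodesic representative passes through the vertices `q * d ^ n` that separate its origin
from the boundary point, as these are cut points. -/
theorem exists_dist_vertex_eq_zero {p : G} {k : Fin 4 → ℤ} {γ : ℝ≥0 → Cover triangleAndPoint}
    (hγ : IsGeodesicRep (vertex p) (boundaryPoint (p * lattice false k)) γ) {n : ℕ} (hn : 0 < n) :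
    ∃ t : ℝ≥0, dist (γ t) (vertex (p * lattice false k * d ^ n)) = 0 ∧ (n : ℝ) ≤ t := by
  obtain ⟨hiso, h0, r, rfl, hr⟩ := hγ
  set q := p * lattice false k with hq
  have hcont : Continuous fun t => lineCoord q (r.1 t) :=
    (continuous_lineCoord q).comp hiso.continuous
  have hz : lineCoord q (r.1 0) = 0 := by rw [h0, lineCoord_vertex]
  have hex : ∀ m : ℕ, ∃ t, lineCoord q (r.1 t) = m := by
    intro m
    have hfin : Metric.hausdorffEDist (Set.range fun t : ℝ≥0 => line q t) (Set.range r.1) ≠ ⊤ := by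
      rw [Metric.hausdorffEDist_comm]
      exact Quotient.exact (s := asymptotic (Cover triangleAndPoint)) hr
    obtain ⟨C, hC⟩ := ENNReal.lt_iff_exists_nnreal_btwn.1 hfin.lt_top
    obtain ⟨_, ⟨t, rfl⟩, ht⟩ := Metric.exists_edist_lt_of_hausdorffEDist_lt
      (s := Set.range fun t : ℝ≥0 => line q t) (x := line q ((m : ℝ≥0) + C : ℝ≥0)) ⟨_, rfl⟩ hC.1
    have hd : dist (line q ((m : ℝ≥0) + C : ℝ≥0)) (r.1 t) < C := by
      rw [edist_nndist] at ht
      exact_mod_cast ht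
    have hle := (abs_lineCoord_sub_le q _ _).trans hd.le
    rw [lineCoord_line] at hle
    have hm : (m : ℝ) ≤ lineCoord q (r.1 t) := by
      have := (abs_le.1 hle).2
      push_cast at this
      linarith
    obtain ⟨s, hs⟩ := intermediate_value_univ 0 t hcont ⟨by rw [hz]; positivity, hm⟩
    exact ⟨s, hs⟩
  obtain ⟨t, ht⟩ := hex n
  obtain ⟨t', ht'⟩ := hex (n + 1)
  have hn' : (0 : ℝ) < n := by exact_mod_cast hn
  have htt' : t ≤ t' := by
    by_contra hlt
    push Not at hlt
    -- the coordinate along the line would exceed its values at both ends of a geodesic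
    have := level_lt_of_between (wall q 3 0) (c := n + 1 / 2)
      (dist_add_dist_of_isometry hiso hlt.le) (by rw [← lineCoord_eq_level, hz]; positivity)
      (by rw [← lineCoord_eq_level, ht]; linarith)
    rw [← lineCoord_eq_level, ht'] at this
    push_cast at this
    linarith
  have h1 := dist_add_dist_of_isometry hiso htt'
  have h2 : dist (r.1 t) (r.1 t') = _ := dist_eq_add_line (q := q) (by rw [ht, ht']; simp)
  have h3 : dist (r.1 t) (r.1 0) = _ := dist_eq_add_line (q := q) (by rw [ht, hz]; exact hn'.ne')
  rw [ht, line_natCast] at h2 h3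
  have h4 := dist_triangle_left (r.1 0) (r.1 t') (vertex (q * d ^ n))
  rw [dist_comm (r.1 0) (r.1 t)] at h1
  refine ⟨t, le_antisymm (by linarith) dist_nonneg, ?_⟩
  have h5 := abs_lineCoord_sub_le q (r.1 t) (r.1 0)
  rw [ht, hz, sub_zero, hiso.dist_eq, NNReal.dist_eq, abs_of_pos hn', NNReal.coe_zero, sub_zero,
    NNReal.abs_eq] at h5
  exact h5

theorem level_eq_of_dist_eq_zero (h : Hyperplane triangleAndPoint) {x y : Cover triangleAndPoint}
    (hxy : dist x y = 0) : h.level x = h.level y := by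
  have := dist_level_le h x y
  rw [hxy] at this
  exact sub_eq_zero.1 (abs_nonpos_iff.1 this)

/-- A geodesic representative crosses exactly the hyperplanes that separate its origin from the
vertices `q * d ^ n` for some `n > 0`. -/
theorem crosses_iff {p : G} {k : Fin 4 → ℤ} {γ : ℝ≥0 → Cover triangleAndPoint}
    (hγ : IsGeodesicRep (vertex p) (boundaryPoint (p * lattice false k)) γ)
    (h : Hyperplane triangleAndPoint) : Crosses γ h ↔
      ∃ n : ℕ, 0 < n ∧ h.Separates {vertex p} {vertex (p * lattice false k * d ^ n)} := by
  constructor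
  · rintro ⟨s, t, hst⟩
    refine ⟨⌈max s t⌉₊ + 1, Nat.succ_pos _, ?_⟩
    obtain ⟨t', h1, h2⟩ := exists_dist_vertex_eq_zero hγ (Nat.succ_pos ⌈max s t⌉₊)
    have h3 := Nat.le_ceil (max s t)
    have h2' : ((⌈max s t⌉₊ + 1 : ℕ) : ℝ≥0) ≤ t' := by exact_mod_cast h2
    have h4 : max s t ≤ t' := h3.trans (le_trans (by simp) h2')
    have hs := dist_add_dist_of_isometry hγ.1 ((le_max_left s t).trans h4)
    have ht := dist_add_dist_of_isometry hγ.1 ((le_max_right s t).trans h4)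
    have h5 := level_eq_of_dist_eq_zero h h1
    rw [separates_singleton_iff, ← h5, ← hγ.2.1]
    rw [separates_singleton_iff] at hst
    have hp := level_vertex_le_or_ge h p
    have hq := level_vertex_le_or_ge h (p * lattice false k * d ^ (⌈max s t⌉₊ + 1))
    rw [← h5] at hq
    rw [← hγ.2.1] at hp
    rcases hp with hp | hp <;> rcases hq with hq | hq
    · have hs' := level_lt_of_between h (c := 1 / 2) hs (by linarith) (by linarith)
      have ht' := level_lt_of_between h (c := 1 / 2) ht (by linarith) (by linarith)
      rcases hst with hst | hst <;> linarith
    · left; constructor <;> linarith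
    · right; constructor <;> linarith
    · have hs' := lt_level_of_between h (c := 1 / 2) hs (by linarith) (by linarith)
      have ht' := lt_level_of_between h (c := 1 / 2) ht (by linarith) (by linarith)
      rcases hst with hst | hst <;> linarith
  · rintro ⟨n, hn, hs⟩
    obtain ⟨t, h1, -⟩ := exists_dist_vertex_eq_zero hγ hn
    refine ⟨0, t, ?_⟩
    rw [separates_singleton_iff] at hs ⊢
    rwa [hγ.2.1, level_eq_of_dist_eq_zero h h1]

/-- The edge from `n` to `n + 1` lies between `0` and `m`. -/
def EdgeBetween (m n : ℤ) : Prop := 0 ≤ n ∧ n < m ∨ m ≤ n ∧ n < 0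

theorem block_three : block 3 = true := rfl

theorem d_pow_eq_lattice (n : ℕ) : d ^ n = lattice true (Pi.single 3 n) := by
  simp [lattice_single, block_three]

/-- A geodesic ray that runs from `p` to `q = p * lattice false k` inside a flat and then leaves
along `d`-edges crosses the hyperplanes between `p` and `q`, and the `d`-edges starting at `q`. -/
theorem crossedFrom_iff (p : G) (k : Fin 4 → ℤ) (h : Hyperplane triangleAndPoint) :
    CrossedFrom p (boundaryPoint (p * lattice false k)) h ↔
      (∃ v n, block v = false ∧ h = wall p v n ∧ EdgeBetween (k v) n) ∨
        ∃ j : ℕ, h = wall (p * lattice false k) 3 j := by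
  have h0 : CrossedFrom p (boundaryPoint (p * lattice false k)) h ↔
      ∃ n : ℕ, 0 < n ∧ h.Separates {vertex p} {vertex (p * lattice false k * d ^ n)} :=
    ⟨fun ⟨γ, hγ, hc⟩ => (crosses_iff hγ h).1 hc, fun hc =>
      ⟨_, isGeodesicRep_bentRay p k, (crosses_iff (isGeodesicRep_bentRay p k) h).2 hc⟩⟩
  rw [h0]
  constructor
  · rintro ⟨n, -, hs⟩
    have hs' : h.Separates {vertex p} {vertex (p * lattice false k)} ∨
        h.Separates {vertex (p * lattice false k)} {vertex (p * lattice false k * d ^ n)} := by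
      rw [separates_singleton_iff] at hs ⊢
      rw [separates_singleton_iff]
      rcases level_vertex_le_or_ge h (p * lattice false k) with h1 | h1 <;>
        rcases hs with ⟨h2, h3⟩ | ⟨h2, h3⟩
      · exact Or.inr (Or.inl ⟨by linarith, h3⟩)
      · exact Or.inl (Or.inr ⟨h2, by linarith⟩)
      · exact Or.inl (Or.inl ⟨h2, by linarith⟩)
      · exact Or.inr (Or.inr ⟨by linarith, h3⟩)
    rcases hs' with hs | hs
    · exact Or.inl ((separates_vertex_mul_lattice_iff h false p k).1 hs)
    · rw [d_pow_eq_lattice] at hs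
      obtain ⟨v, j, hv, rfl, hj⟩ := (separates_vertex_mul_lattice_iff h true _ _).1 hs
      have h3 : ∀ v, block v = true → v = 3 := by decide
      have hv : v = 3 := h3 v hv
      subst hv
      simp only [Pi.single_eq_same] at hj
      refine Or.inr ⟨j.toNat, ?_⟩
      rw [Int.toNat_of_nonneg (by omega)]
  · rintro (⟨v, n, hv, rfl, hn⟩ | ⟨j, rfl⟩)
    · refine ⟨1, one_pos, ?_⟩
      have hs := (separates_vertex_mul_lattice_iff (wall p v n) false p k).2 ⟨v, n, hv, rfl, hn⟩
      rw [separates_singleton_iff] at hs ⊢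
      have : (wall p v n).level (vertex (p * lattice false k * d ^ 1)) =
          (wall p v n).level (vertex (p * lattice false k)) := by
        rw [level_wall_vertex, level_wall_vertex, d_pow_eq_lattice, ← mul_assoc, hv,
          lead_mul_lattice _ _ _ _ (Or.inl (by simp))]
      rwa [this]
    · refine ⟨j + 1, Nat.succ_pos _, ?_⟩
      have hs := (separates_vertex_mul_lattice_iff (wall (p * lattice false k) 3 j) true
        (p * lattice false k) (Pi.single 3 ((j + 1 : ℕ) : ℤ))).2
        ⟨3, j, rfl, rfl, Or.inl ⟨by omega, by simp⟩⟩
      rw [← d_pow_eq_lattice] at hs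
      rw [separates_singleton_iff] at hs ⊢
      have : (wall (p * lattice false k) 3 j).level (vertex p) =
          (wall (p * lattice false k) 3 j).level (vertex (p * lattice false k)) := by
        rw [level_wall_vertex, level_wall_vertex, inv_mul_cancel, lead_one, mul_inv_rev,
          inv_mul_cancel_right, ← lattice_neg, block_three, lead_lattice_of_ne (by simp)]
      rwa [this]

theorem wall_injective {p : G} {v v' : Fin 4} {n n' : ℤ} (h : wall p v n = wall p v' n') :
    v = v' ∧ n = n' := by
  have hv : v = v' := congrArg Hyperplane.dir h
  subst hv
  have := congrArg (fun h => h.level (vertex p)) h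
  simp only [level_wall_vertex, inv_mul_cancel, lead_one, Int.cast_inj] at this
  exact ⟨rfl, by simpa using this⟩

/-- Distinct vertices of a flat start distinct `d`-lines. -/
theorem restrict_eq_of_wall_eq {p : G} {k k' : Fin 4 → ℤ} {j j' : ℤ}
    (h : wall (p * lattice false k) 3 j = wall (p * lattice false k') 3 j') :
    restrict false k = restrict false k' := by
  by_contra hne
  have hl : ∀ m : ℕ,
      lead true ((p * lattice false k)⁻¹ * (p * lattice false k' * d ^ m)) 3 = 0 := by
    intro m
    have h1 : (p * lattice false k)⁻¹ * (p * lattice false k' * d ^ m) =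
        lattice false (-k + k') * lattice true (Pi.single 3 m) := by
      rw [lattice_add, lattice_neg, d_pow_eq_lattice]; group
    rw [h1, lead_mul_lattice, lead_lattice_of_ne (by simp)]
    · rfl
    · right
      intro w hw
      have h2 := congrArg (lead false) hw
      rw [lead_lattice, lead_lattice_of_ne (by simp)] at h2
      apply hne
      ext v
      have h3 := congrFun h2 v
      by_cases hv : block v = false
      · simp only [restrict, hv, if_true, Pi.add_apply, Pi.neg_apply, Pi.zero_apply] at h3 ⊢
        omega
      · simp [restrict, hv]
  have hr : ∀ m : ℕ,
      lead true ((p * lattice false k')⁻¹ * (p * lattice false k' * d ^ m)) 3 = m := by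
    intro m
    rw [inv_mul_cancel_left, d_pow_eq_lattice, lead_lattice]
    simp [restrict, block_three]
  have h1 := congrArg (fun h => h.level (vertex (p * lattice false k' * d ^ 0))) h
  have h2 := congrArg (fun h => h.level (vertex (p * lattice false k' * d ^ 1))) h
  simp only [level_wall_vertex, block_three, hl, hr, Int.cast_inj] at h1 h2
  omega

theorem crossedFrom_wall_iff (p : G) (k : Fin 4 → ℤ) {v : Fin 4} (hv : block v = false) (n : ℤ) :
    CrossedFrom p (boundaryPoint (p * lattice false k)) (wall p v n) ↔ EdgeBetween (k v) n := by
  rw [crossedFrom_iff]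
  constructor
  · rintro (⟨v', n', -, h, hn⟩ | ⟨j, h⟩)
    · obtain ⟨rfl, rfl⟩ := wall_injective h
      exact hn
    · have : v = 3 := congrArg Hyperplane.dir h
      subst this
      simp [block_three] at hv
  · exact fun hn => Or.inl ⟨v, n, hv, rfl, hn⟩

/-! ### The two products -/

theorem level_wall_line (p : G) (k : Fin 4 → ℤ) {v : Fin 4} (hv : block v = false) (n : ℤ) (t : ℝ) :
    (wall p v n).level (line (p * lattice false k) t) = k v - n := by
  rw [level_wall, line, hv, proj_flat_of_disjoint _ _ _ _ (Or.inl (by simp)), inv_mul_cancel_left,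
    lead_lattice]
  simp [restrict, hv]

/-- The hyperplanes counted by the Gromov product of two distinct boundary points: those between the
base point and both exits from the flat. -/
theorem gromovProd_eq (p : G) (k k' : Fin 4 → ℤ) (hne : restrict false k ≠ restrict false k') :
    gromovProd p (boundaryPoint (p * lattice false k)) (boundaryPoint (p * lattice false k')) =
      Set.encard ((fun e : Fin 4 × ℤ => wall p e.1 e.2) ''
        {e | block e.1 = false ∧ EdgeBetween (k e.1) e.2 ∧ EdgeBetween (k' e.1) e.2}) := by
  rw [gromovProd]
  congr 1
  ext h
  constructor
  · rintro ⟨γ, γ', hγ, hγ', T, hs⟩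
    rw [separates_iff h (Set.singleton_nonempty _) ⟨γ T, Or.inl ⟨T, Set.self_mem_Ici, rfl⟩⟩] at hs
    have hc : CrossedFrom p (boundaryPoint (p * lattice false k)) h := by
      refine ⟨γ, hγ, 0, T, ?_⟩
      rw [separates_singleton_iff, hγ.2.1]
      exact hs.imp (fun hs => ⟨hs.1 _ rfl, hs.2 _ (Or.inl ⟨T, Set.self_mem_Ici, rfl⟩)⟩)
        (fun hs => ⟨hs.1 _ rfl, hs.2 _ (Or.inl ⟨T, Set.self_mem_Ici, rfl⟩)⟩)
    have hc' : CrossedFrom p (boundaryPoint (p * lattice false k')) h := by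
      refine ⟨γ', hγ', 0, T, ?_⟩
      rw [separates_singleton_iff, hγ'.2.1]
      exact hs.imp (fun hs => ⟨hs.1 _ rfl, hs.2 _ (Or.inr ⟨T, Set.self_mem_Ici, rfl⟩)⟩)
        (fun hs => ⟨hs.1 _ rfl, hs.2 _ (Or.inr ⟨T, Set.self_mem_Ici, rfl⟩)⟩)
    rcases (crossedFrom_iff p k h).1 hc with ⟨v, n, hv, rfl, hn⟩ | ⟨j, rfl⟩
    · exact ⟨(v, n), ⟨hv, hn, (crossedFrom_wall_iff p k' hv n).1 hc'⟩, rfl⟩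
    · rcases (crossedFrom_iff p k' _).1 hc' with ⟨v, n, hv, h, hn⟩ | ⟨j', h⟩
      · have : 3 = v := congrArg Hyperplane.dir h
        subst this
        simp [block_three] at hv
      · exact (hne (restrict_eq_of_wall_eq h)).elim
  · rintro ⟨⟨v, n⟩, ⟨hv, hn, hn'⟩, rfl⟩
    dsimp only at hv hn hn' ⊢
    refine ⟨_, _, isGeodesicRep_bentRay p k, isGeodesicRep_bentRay p k',
      ‖truncate false (intVec k)‖₊ + ‖truncate false (intVec k')‖₊ + 1, ?_⟩
    have hlev : ∀ x ∈ bentRay p k ''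
          Set.Ici (‖truncate false (intVec k)‖₊ + ‖truncate false (intVec k')‖₊ + 1) ∪
        bentRay p k' ''
          Set.Ici (‖truncate false (intVec k)‖₊ + ‖truncate false (intVec k')‖₊ + 1),
        (wall p v n).level x = ((k v - n : ℤ) : ℝ) ∨
          (wall p v n).level x = ((k' v - n : ℤ) : ℝ) := by
      have h1 := norm_nonneg (truncate false (intVec k))
      have h2 := norm_nonneg (truncate false (intVec k'))
      rintro x (⟨t, ht, rfl⟩ | ⟨t, ht, rfl⟩)
      · have ht : ‖truncate false (intVec k)‖ + ‖truncate false (intVec k')‖ + 1 ≤ t := ht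
        left
        rw [bentRay, if_neg (by linarith), level_wall_line p k hv]
        push_cast; rfl
      · have ht : ‖truncate false (intVec k)‖ + ‖truncate false (intVec k')‖ + 1 ≤ t := ht
        right
        rw [bentRay, if_neg (by linarith), level_wall_line p k' hv]
        push_cast; rfl
    rw [separates_iff _ (Set.singleton_nonempty _) ⟨_, Or.inl ⟨_, Set.self_mem_Ici, rfl⟩⟩]
    have hp : (wall p v n).level (vertex p) = ((-n : ℤ) : ℝ) := by
      rw [level_wall_vertex]; simp
    have hpos : ∀ m : ℤ, 0 < m → (1 / 2 : ℝ) < m := fun m hm => by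
      have : (1 : ℝ) ≤ m := by exact_mod_cast hm
      linarith
    have hneg : ∀ m : ℤ, m ≤ 0 → (m : ℝ) < 1 / 2 := fun m hm => by
      have : (m : ℝ) ≤ 0 := by exact_mod_cast hm
      linarith
    unfold EdgeBetween at hn hn'
    rcases le_or_gt 0 n with h0 | h0
    · left
      refine ⟨?_, fun x hx => ?_⟩
      · rintro _ rfl
        rw [hp]; exact hneg _ (by omega)
      · rcases hlev x hx with h | h <;> rw [h] <;> exact hpos _ (by omega)
    · right
      refine ⟨?_, fun x hx => ?_⟩
      · rintro _ rfl
        rw [hp]; exact hpos _ (by omega)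
      · rcases hlev x hx with h | h <;> rw [h] <;> exact hneg _ (by omega)

theorem exists_midpoint_mem_carrier (p : G) (v : Fin 4) (n : ℤ) :
    ∃ m ∈ (wall p v n).carrier,
      dist m (vertex (p * lattice (block v) (Pi.single v n))) ≤ 1 / 2 ∧
      dist m (vertex (p * lattice (block v) (Pi.single v (n + 1)))) ≤ 1 / 2 := by
  have hint : ∀ j : ℤ, (intVec (Pi.single v j) : Vec) = EuclideanSpace.single v (j : ℝ) := by
    intro j
    ext w; by_cases h : w = v
    · subst h; simp
    · simp [h]
  refine ⟨flat (block v) p (EuclideanSpace.single v ((n : ℝ) + 1 / 2)), ?_, ?_, ?_⟩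
  · rw [mem_carrier_iff, level_wall, proj_flat]
    simp [truncate_apply]
  · rw [← flat_intVec, hint]
    refine (dist_flat_le _ _ _ _).trans ?_
    rw [PiLp.dist_single_same, Real.dist_eq]
    simp
  · rw [← flat_intVec, hint]
    refine (dist_flat_le _ _ _ _).trans ?_
    rw [PiLp.dist_single_same, Real.dist_eq, abs_le]
    push_cast
    constructor <;> linarith

/-- A hyperplane that separates a vertex from another hyperplane also separates it from the vertices
adjacent to that hyperplane. -/
theorem separates_vertex_of_separates_carrier {h k : Hyperplane triangleAndPoint} {p q : G}
    {m : Cover triangleAndPoint} (hm : m ∈ k.carrier) (hmq : dist m (vertex q) ≤ 1 / 2)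
    (hs : h.Separates {vertex p} k.carrier) : h.Separates {vertex p} {vertex q} := by
  rw [separates_iff h (Set.singleton_nonempty _) ⟨m, hm⟩] at hs
  rw [separates_singleton_iff]
  have h1 := abs_le.1 ((dist_level_le h m (vertex q)).trans hmq)
  rcases hs with ⟨h2, h3⟩ | ⟨h2, h3⟩
  · have h3 := h3 m hm
    rcases level_vertex_le_or_ge h q with h4 | h4
    · linarith
    · exact Or.inl ⟨h2 _ rfl, by linarith⟩
  · have h3 := h3 m hm
    rcases level_vertex_le_or_ge h q with h4 | h4
    · exact Or.inr ⟨h2 _ rfl, by linarith⟩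
    · linarith

/-- The `n`-th hyperplane that the line through `p` in direction `v` crosses is separated from `p`
by the `n` hyperplanes before it. -/
theorem numSeparating_wall (p : G) (v : Fin 4) (n : ℕ) : numSeparating p (wall p v n) = n := by
  obtain ⟨m, hm, hm', -⟩ := exists_midpoint_mem_carrier p v n
  have hset : {h : Hyperplane triangleAndPoint | h.Separates {vertex p} (wall p v n).carrier} =
      (fun j : ℕ => wall p v j) '' (Finset.range n : Set ℕ) := by
    ext h
    constructor
    · intro hs
      have hs := separates_vertex_of_separates_carrier hm hm' hs
      obtain ⟨w, j, hw, rfl, hj⟩ := (separates_vertex_mul_lattice_iff _ _ _ _).1 hs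
      by_cases hvw : w = v
      · subst hvw
        simp only [Pi.single_eq_same] at hj
        refine ⟨j.toNat, by simp; omega, ?_⟩
        simp only [Int.toNat_of_nonneg (show 0 ≤ j by omega)]
      · simp only [Pi.single_eq_of_ne hvw] at hj
        omega
    · rintro ⟨j, hj, rfl⟩
      have hj : j < n := by simpa using hj
      refine (separates_iff _ (Set.singleton_nonempty _) ⟨m, hm⟩).2 (Or.inl ⟨?_, fun x hx => ?_⟩)
      · rintro _ rfl
        rw [level_wall_vertex]
        have : (0 : ℝ) ≤ j := by positivity
        simp only [inv_mul_cancel, lead_one, Pi.zero_apply, zero_sub]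
        push_cast; linarith
      · rw [mem_carrier_iff, level_wall] at hx
        rw [level_wall]
        have : (j : ℝ) + 1 ≤ n := by exact_mod_cast hj
        push_cast at hx ⊢
        linarith
  rw [numSeparating, hset, Set.InjOn.encard_image, Set.encard_coe_eq_coe_finsetCard,
    Finset.card_range]
  intro j _ j' _ h
  exact_mod_cast (wall_injective h).2

theorem numSeparating_wall_neg_one (p : G) (v : Fin 4) : numSeparating p (wall p v (-1)) = 0 := by
  obtain ⟨m, hm, -, hm'⟩ := exists_midpoint_mem_carrier p v (-1)
  rw [numSeparating, Set.encard_eq_zero, Set.eq_empty_iff_forall_notMem]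
  intro h hs
  have hs := separates_vertex_of_separates_carrier hm hm' hs
  rw [separates_singleton_iff] at hs
  simp only [neg_add_cancel, Pi.single_zero, lattice_zero, mul_one] at hs
  rcases hs with hs | hs <;> linarith

theorem flat_proj_of_mem (i : Bool) (p : G) (x : Cover triangleAndPoint) {k : Fin 4 → ℤ}
    (hk : x.base = p * lattice i k) (hx : ∀ v, x.coord v ≠ 0 → block v = i) :
    flat i p (proj i p x) = x := by
  have h : x = flat i x.base (WithLp.toLp 2 x.coord) := by
    have h0 : ∀ v, ⌊x.coord v⌋ = 0 := fun v =>
      Int.floor_eq_zero_iff.2 ⟨x.nonneg v, x.lt_one v⟩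
    ext v
    · simp only [flat, h0]
      exact (mul_one _).symm.trans (congrArg _ (lattice_zero i).symm)
    · by_cases hv : block v = i
      · simp [flat, restrict, hv, Int.fract, h0]
      · have : x.coord v = 0 := by_contra fun h => hv (hx v h)
        simp [flat, restrict, hv, this]
  rw [h, hk, flat_mul_lattice, flat_proj_flat]

/-- A `d`-edge is a cut edge: the hyperplane dual to it is a point of the line of `d`-edges. -/
theorem eq_line_of_mem_carrier {q : G} {j : ℤ} {x : Cover triangleAndPoint}
    (hx : x ∈ (wall q 3 j).carrier) : x = line q (lineCoord q x) := by
  classical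
  rw [← flat_proj_eq_line]
  have h1 := (mem_carrier_iff _ _).1 hx
  rw [level_wall, block_three, proj_apply] at h1
  obtain ⟨v, hv, h2⟩ := hx
  have h3 : v = 3 := congrArg Hyperplane.dir h2
  subst h3
  obtain ⟨i, hi⟩ := exists_block_of_isClique x.clique
  have hi3 : true = i := hi 3 (by simp [hv])
  subst hi3
  split_ifs at h1 with hk
  · obtain ⟨l, hl⟩ := hk
    exact (flat_proj_of_mem true q x (by rw [← hl, mul_inv_cancel_left]) hi).symm
  · have h4 : (2 * (lead true (q⁻¹ * x.base) 3 - j) : ℝ) = 1 := by linarith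
    have h5 : 2 * (lead true (q⁻¹ * x.base) 3 - j) = 1 := by exact_mod_cast h4
    omega

/-- The hyperplanes between `p` and `q` separate `p` from the `d`-edges on the line through `q`. -/
theorem le_numSeparating_wall (p : G) (k : Fin 4 → ℤ) {v : Fin 4} (hv : block v = false) {n : ℕ}
    (hn : n ≤ k v) (j : ℤ) : n ≤ numSeparating p (wall (p * lattice false k) 3 j) := by
  have hcard : ((fun j : ℕ => wall p v j) '' (Finset.range n : Set ℕ)).encard = n := by
    rw [Set.InjOn.encard_image, Set.encard_coe_eq_coe_finsetCard, Finset.card_range]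
    intro j _ j' _ h
    exact_mod_cast (wall_injective h).2
  rw [← hcard, numSeparating]
  refine Set.encard_le_encard ?_
  rintro _ ⟨i, hi, rfl⟩
  have hi : i < n := by simpa using hi
  obtain ⟨m, hm, -⟩ := exists_midpoint_mem_carrier (p * lattice false k) 3 j
  refine (separates_iff _ (Set.singleton_nonempty _) ⟨m, hm⟩).2 (Or.inl ⟨?_, fun x hx => ?_⟩)
  · rintro _ rfl
    rw [level_wall_vertex]
    have : (0 : ℝ) ≤ i := by positivity
    simp only [inv_mul_cancel, lead_one, Pi.zero_apply, zero_sub]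
    push_cast; linarith
  · -- the point `x` lies on the line through `q`, which projects to `q`
    have hline : x = line (p * lattice false k) (lineCoord (p * lattice false k) x) :=
      eq_line_of_mem_carrier hx
    rw [hline, level_wall_line p k hv]
    have h1 : ((i : ℤ) : ℝ) + 1 ≤ k v := by
      have : (i : ℤ) + 1 ≤ k v := by omega
      exact_mod_cast this
    linarith

/-- The bracket of two boundary points vanishes if a hyperplane adjacent to the base point lies
between the base point and exactly one of the exits from the flat. -/
theorem bracket_eq_zero (p : G) (k k' : Fin 4 → ℤ) {v : Fin 4} (hv : block v = false) {n : ℤ}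
    (hn : n = 0 ∨ n = -1) (h : Xor (EdgeBetween (k v) n) (EdgeBetween (k' v) n)) :
    bracket p (boundaryPoint (p * lattice false k)) (boundaryPoint (p * lattice false k')) = 0 := by
  have hmem : wall p v n ∈ crossedByOne p (boundaryPoint (p * lattice false k))
      (boundaryPoint (p * lattice false k')) := by
    change Xor (CrossedFrom _ _ _) (CrossedFrom _ _ _)
    rwa [crossedFrom_wall_iff p k hv, crossedFrom_wall_iff p k' hv]
  have h0 : numSeparating p (wall p v n) = 0 := by
    rcases hn with rfl | rfl
    · exact_mod_cast numSeparating_wall p v 0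
    · exact numSeparating_wall_neg_one p v
  exact nonpos_iff_eq_zero.1 ((iInf₂_le _ hmem).trans h0.le)

/-- If two exits from the flat differ by one edge at height `m`, then the hyperplanes crossed by one
ray only are the dual hyperplane of that edge and the `d`-edges, which lie behind the first `m`
hyperplanes in the direction of the edge. -/
theorem bracket_eq_natCast (p : G) (k k' : Fin 4 → ℤ) {v : Fin 4} (hv : block v = false) (m : ℕ)
    (hk : k v = m) (hk' : k' v = m + 1) (h : ∀ w ≠ v, k w = k' w) :
    bracket p (boundaryPoint (p * lattice false k)) (boundaryPoint (p * lattice false k')) = m := by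
  refine le_antisymm ?_ (le_iInf₂ fun h' hx => ?_)
  · have hmem : wall p v m ∈ crossedByOne p (boundaryPoint (p * lattice false k))
        (boundaryPoint (p * lattice false k')) := by
      change Xor (CrossedFrom _ _ _) (CrossedFrom _ _ _)
      rw [crossedFrom_wall_iff p k hv, crossedFrom_wall_iff p k' hv, hk, hk']
      refine Or.inr ⟨Or.inl ⟨by omega, by omega⟩, ?_⟩
      unfold EdgeBetween; omega
    exact (iInf₂_le _ hmem).trans (numSeparating_wall p v m).le
  · have key : ∀ w n, block w = false → Xor (EdgeBetween (k w) n) (EdgeBetween (k' w) n) →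
        (m : ℕ∞) ≤ numSeparating p (wall p w n) := by
      intro w n hw hx
      by_cases hwv : w = v
      · subst hwv
        rw [hk, hk'] at hx
        have hnm : n = m := by
          unfold EdgeBetween Xor at hx; omega
        rw [hnm, numSeparating_wall]
      · rw [h w hwv] at hx
        simp [xor_self] at hx
    have hflat : ∀ w n, block w = false → h' = wall p w n →
        (m : ℕ∞) ≤ numSeparating p h' := by
      rintro w n hw rfl
      change Xor (CrossedFrom _ _ _) (CrossedFrom _ _ _) at hx
      rw [crossedFrom_wall_iff p k hw, crossedFrom_wall_iff p k' hw] at hx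
      exact key w n hw hx
    rcases hx with ⟨hx, -⟩ | ⟨hx, -⟩
    · rcases (crossedFrom_iff p k h').1 hx with ⟨w, n, hw, hh, -⟩ | ⟨j, rfl⟩
      · exact hflat w n hw hh
      · exact le_numSeparating_wall p k hv (by omega) j
    · rcases (crossedFrom_iff p k' h').1 hx with ⟨w, n, hw, hh, -⟩ | ⟨j, rfl⟩
      · exact hflat w n hw hh
      · exact le_numSeparating_wall p k' hv (by omega) j

theorem gromovProd_eq_encard (p : G) (k k' : Fin 4 → ℤ)
    (hne : restrict false k ≠ restrict false k') :
    gromovProd p (boundaryPoint (p * lattice false k)) (boundaryPoint (p * lattice false k')) =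
      Set.encard {e : Fin 4 × ℤ |
        block e.1 = false ∧ EdgeBetween (k e.1) e.2 ∧ EdgeBetween (k' e.1) e.2} := by
  rw [gromovProd_eq p k k' hne, Set.InjOn.encard_image]
  rintro ⟨v, n⟩ _ ⟨v', n'⟩ _ h
  obtain ⟨rfl, rfl⟩ := wall_injective h
  rfl

theorem ne_of_bracket_eq_zero {o : G} {ξ η : Bdry} (h : bracket o ξ η = 0) : ξ ≠ η := by
  rintro rfl
  have : bracket o ξ ξ = ⊤ := by
    simp only [bracket, iInf_eq_top]
    intro k hk
    exact absurd hk (by simp [crossedByOne, xor_self])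
  rw [this] at h
  exact absurd h (by simp)

/-! ### The metric -/

theorem expNeg_nonneg (n : ℕ∞) : 0 ≤ expNeg n := by
  unfold expNeg; split_ifs <;> positivity

theorem expNeg_antitone : Antitone expNeg := by
  intro m n hmn
  by_cases hn : n = ⊤
  · subst hn; exact (if_pos rfl).le.trans (expNeg_nonneg m)
  · have hm : m ≠ ⊤ := ne_top_of_le_ne_top hn hmn
    rw [expNeg, expNeg, if_neg hn, if_neg hm]
    refine Real.exp_le_exp.2 (neg_le_neg ?_)
    exact_mod_cast ENat.toNat_le_toNat hmn hn

open scoped Classical in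
theorem abs_bump_sub_bump (o : G) (ξ η : Bdry) (k : Hyperplane triangleAndPoint) :
    |bump o k ξ - bump o k η| =
      if k ∈ crossedByOne o ξ η then expNeg (numSeparating o k) else 0 := by
  have hmem : k ∈ crossedByOne o ξ η ↔ Xor (CrossedFrom o ξ k) (CrossedFrom o η k) := Iff.rfl
  have h0 := abs_of_nonneg (expNeg_nonneg (numSeparating o k))
  rw [if_congr hmem rfl rfl, bump, bump]
  by_cases h1 : CrossedFrom o ξ k <;> by_cases h2 : CrossedFrom o η k <;> simp [h1, h2, h0, Xor]

theorem boundaryDist_eq_expNeg_bracket (o : G) (ξ η : Bdry) :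
    boundaryDist o ξ η = expNeg (bracket o ξ η) := by
  classical
  simp only [boundaryDist, abs_bump_sub_bump]
  by_cases hS : (crossedByOne o ξ η).Nonempty
  · obtain ⟨k, hk, hmin⟩ : ∃ k ∈ crossedByOne o ξ η, numSeparating o k = bracket o ξ η := by
      have h := csInf_mem (hS.image (numSeparating o))
      rw [sInf_image] at h
      exact h
    have hle : ∀ k', (if k' ∈ crossedByOne o ξ η then expNeg (numSeparating o k') else 0) ≤
        expNeg (bracket o ξ η) := by
      intro k'
      split_ifs with hk'
      · exact expNeg_antitone (iInf₂_le _ hk')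
      · exact expNeg_nonneg _
    have : Nonempty (Hyperplane triangleAndPoint) := ⟨k⟩
    refine le_antisymm (ciSup_le hle) ?_
    refine le_trans ?_ (le_ciSup ⟨_, Set.forall_mem_range.2 hle⟩ k)
    rw [if_pos hk, hmin]
  · rw [Set.not_nonempty_iff_eq_empty] at hS
    simp [bracket, hS, expNeg]

/-! ### The four points -/

theorem lattice_vec (x y z : ℤ) : lattice false ![x, y, z, 0] = a ^ x * b ^ y * c ^ z := by
  have h : (![x, y, z, 0] : Fin 4 → ℤ) = Pi.single 0 x + Pi.single 1 y + Pi.single 2 z := by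
    ext v; fin_cases v <;> simp
  rw [h, lattice_add, lattice_add, lattice_single, lattice_single, lattice_single]
  simp [block]

/-- The four points in coordinates around the base point `o * c ^ (-m)`. -/
theorem boundaryPoint_eq_shift (o : G) (m : ℕ) (x y z : ℤ) :
    boundaryPoint (o * lattice false ![x, y, z, 0]) =
      boundaryPoint (o * c⁻¹ ^ m * lattice false ![x, y, z + m, 0]) := by
  have h : c⁻¹ ^ m = lattice false ![0, 0, -m, 0] := by rw [lattice_vec]; simp
  rw [h, mul_assoc, ← lattice_add]
  congr 3
  ext v; fin_cases v <;> simp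

theorem brackets_shift (o : G) (n m : ℕ) :
    bracket (o * c⁻¹ ^ m) (boundaryPoint (o * lattice false ![n, 0, 0, 0]))
      (boundaryPoint (o * lattice false ![n, 1, 0, 0])) = 0 ∧
    bracket (o * c⁻¹ ^ m) (boundaryPoint (o * lattice false ![-1, -1, 0, 0]))
      (boundaryPoint (o * lattice false ![-1, -1, 1, 0])) = m ∧
    (∀ z, bracket (o * c⁻¹ ^ m) (boundaryPoint (o * lattice false ![n, 0, 0, 0]))
      (boundaryPoint (o * lattice false ![-1, -1, z, 0])) = 0) ∧
    ∀ z, bracket (o * c⁻¹ ^ m) (boundaryPoint (o * lattice false ![n, 1, 0, 0]))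
      (boundaryPoint (o * lattice false ![-1, -1, z, 0])) = 0 := by
  have hb : block 1 = false := rfl
  simp only [boundaryPoint_eq_shift o m]
  refine ⟨?_, ?_, fun z => ?_, fun z => ?_⟩
  · exact bracket_eq_zero _ _ _ hb (n := 0) (Or.inl rfl) (by simp [EdgeBetween, Xor])
  · refine bracket_eq_natCast _ _ _ (v := 2) rfl m (by simp) (by simp; ring) fun w hw => ?_
    fin_cases w <;> simp at hw ⊢
  · exact bracket_eq_zero _ _ _ hb (n := -1) (Or.inr rfl) (by simp [EdgeBetween, Xor])
  · exact bracket_eq_zero _ _ _ hb (n := -1) (Or.inr rfl) (by simp [EdgeBetween, Xor])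

theorem gromovProd_eq_zero (o : G) (n : ℕ) (y z : ℤ) (hy : 0 ≤ y) :
    gromovProd o (boundaryPoint (o * lattice false ![n, y, 0, 0]))
      (boundaryPoint (o * lattice false ![-1, -1, z, 0])) = 0 := by
  rw [gromovProd_eq_encard, Set.encard_eq_zero, Set.eq_empty_iff_forall_notMem]
  · rintro ⟨v, j⟩ ⟨-, h1, h2⟩
    fin_cases v <;> simp [EdgeBetween] at h1 h2 <;> omega
  · intro h
    have := congrFun h 1
    simp [restrict, block] at this
    omega

theorem gromovProd_w_x (o : G) (n : ℕ) :
    gromovProd o (boundaryPoint (o * lattice false ![n, 0, 0, 0]))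
      (boundaryPoint (o * lattice false ![n, 1, 0, 0])) = n := by
  rw [gromovProd_eq_encard]
  · have h : {e : Fin 4 × ℤ | block e.1 = false ∧
        EdgeBetween ((![n, 0, 0, 0] : Fin 4 → ℤ) e.1) e.2 ∧
        EdgeBetween ((![n, 1, 0, 0] : Fin 4 → ℤ) e.1) e.2} =
        (fun j : ℕ => ((0 : Fin 4), (j : ℤ))) '' (Finset.range n : Set ℕ) := by
      ext ⟨v, j⟩
      constructor
      · rintro ⟨-, h1, h2⟩
        have h0 : v = 0 ∧ 0 ≤ j ∧ j < n := by
          fin_cases v <;> simp [EdgeBetween] at h1 h2 ⊢ <;> omega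
        obtain ⟨rfl, hj, hj'⟩ := h0
        refine ⟨j.toNat, by simp; omega, ?_⟩
        simp [hj]
      · rintro ⟨i, hi, h⟩
        have hi : i < n := by simpa using hi
        obtain ⟨rfl, rfl⟩ := Prod.mk.inj h
        exact ⟨rfl, Or.inl ⟨by omega, by simpa using hi⟩, Or.inl ⟨by omega, by simpa using hi⟩⟩
    rw [h, Set.InjOn.encard_image, Set.encard_coe_eq_coe_finsetCard, Finset.card_range]
    intro i _ j _ h
    simpa using h
  · intro h
    have := congrFun h 1
    simp [restrict, block] at this

theorem gromovProd_y_z (o : G) :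
    gromovProd o (boundaryPoint (o * lattice false ![-1, -1, 0, 0]))
      (boundaryPoint (o * lattice false ![-1, -1, 1, 0])) = 2 := by
  rw [gromovProd_eq_encard]
  · have h : {e : Fin 4 × ℤ | block e.1 = false ∧
        EdgeBetween ((![-1, -1, 0, 0] : Fin 4 → ℤ) e.1) e.2 ∧
        EdgeBetween ((![-1, -1, 1, 0] : Fin 4 → ℤ) e.1) e.2} = {(0, -1), (1, -1)} := by
      ext ⟨v, j⟩
      constructor
      · rintro ⟨-, h1, h2⟩
        have h0 : (v = 0 ∨ v = 1) ∧ j = -1 := by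
          fin_cases v <;> simp [EdgeBetween] at h1 h2 ⊢ <;> omega
        rcases h0 with ⟨rfl | rfl, rfl⟩ <;> simp
      · rintro (h | h) <;> obtain ⟨rfl, rfl⟩ := Prod.mk.inj h <;> simp [EdgeBetween, block]
    rw [h, Set.encard_pair (by simp)]
  · intro h
    have := congrFun h 2
    simp [restrict, block] at this

/-- The assertions about the four points, for all base points `o * c ^ (-m)`. -/
theorem four_points (o : G) (n : ℕ) (w x y z : Bdry)
    (hw : w = boundaryPoint (o * lattice false ![n, 0, 0, 0]))
    (hx : x = boundaryPoint (o * lattice false ![n, 1, 0, 0]))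
    (hy : y = boundaryPoint (o * lattice false ![-1, -1, 0, 0]))
    (hz : z = boundaryPoint (o * lattice false ![-1, -1, 1, 0])) :
    [w, x, y, z].Pairwise (· ≠ ·) ∧
    bracket o w x = 0 ∧ bracket o w y = 0 ∧ bracket o w z = 0 ∧ bracket o x z = 0 ∧
    bracket o y z = 0 ∧
    gromovProd o w x = n ∧ gromovProd o w y = 0 ∧ gromovProd o w z = 0 ∧ gromovProd o x z = 0 ∧
    gromovProd o y z = 2 ∧ cr o w x y z = 0 ∧ bfm o w x y z = n + 2 ∧
    ∀ m : ℕ, bracket (o * c⁻¹ ^ m) w x = 0 ∧ bracket (o * c⁻¹ ^ m) y z = m ∧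
      bracket (o * c⁻¹ ^ m) w y = 0 ∧ bracket (o * c⁻¹ ^ m) x z = 0 ∧
      cr (o * c⁻¹ ^ m) w x y z = m := by
  subst hw hx hy hz
  have h0 := brackets_shift o n 0
  simp only [pow_zero, mul_one, Nat.cast_zero] at h0
  obtain ⟨hwx, hyz, hwy, hxy⟩ := h0
  have gwx := gromovProd_w_x o n
  have gyz := gromovProd_y_z o
  have gw := fun z => gromovProd_eq_zero o n 0 z le_rfl
  have gx := fun z => gromovProd_eq_zero o n 1 z zero_le_one
  refine ⟨?_, hwx, hwy 0, hwy 1, hxy 1, hyz, gwx, gw 0, gw 1, gx 1, gyz, ?_, ?_, fun m => ?_⟩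
  · have h1 := ne_of_bracket_eq_zero hwx
    have h2 := ne_of_bracket_eq_zero (hwy 0)
    have h3 := ne_of_bracket_eq_zero (hwy 1)
    have h4 := ne_of_bracket_eq_zero (hxy 0)
    have h5 := ne_of_bracket_eq_zero (hxy 1)
    have h6 := ne_of_bracket_eq_zero hyz
    simp only [List.pairwise_cons, List.mem_cons, forall_eq_or_imp, List.not_mem_nil,
      IsEmpty.forall_iff, implies_true, List.Pairwise.nil, and_true]
    exact ⟨⟨h1, h2, h3⟩, ⟨h4, h5⟩, h6⟩
  · simp [cr, hwx, hyz, hwy 0, hxy 1]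
  · simp [bfm, gwx, gyz, gw 0, gx 1]
  · obtain ⟨hwx, hyz, hwy, hxy⟩ := brackets_shift o n m
    exact ⟨hwx, hyz, hwy 0, hxy 1, by rw [cr, hwx, hyz, hwy 0, hxy 1]; simp⟩

end MorseCube

end

theorem mainTheorem7 :
    -- the products are the exponents of the metrics
    (∀ (o : MorseCube.G) (ξ η : MorseCube.Bdry),
      MorseCube.boundaryDist o ξ η = MorseCube.expNeg (MorseCube.bracket o ξ η)) ∧
    -- the explicit points, for an arbitrary vertex `o` in the role of `1`
    (∀ o : MorseCube.G, ∃ (w x : ℕ → MorseCube.Bdry) (y z : MorseCube.Bdry),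
      (∀ n, MorseCube.Represents o
        (MorseCube.eventually (List.replicate n MorseCube.a) MorseCube.d) (w n)) ∧
      (∀ n, MorseCube.Represents o
        (MorseCube.eventually (List.replicate n MorseCube.a ++ [MorseCube.b]) MorseCube.d) (x n)) ∧
      MorseCube.Represents o
        (MorseCube.eventually [MorseCube.a⁻¹, MorseCube.b⁻¹] MorseCube.d) y ∧
      MorseCube.Represents o
        (MorseCube.eventually [MorseCube.a⁻¹, MorseCube.b⁻¹, MorseCube.c] MorseCube.d) z ∧
      (∀ n : ℕ,
        [w n, x n, y, z].Pairwise (· ≠ ·) ∧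
        MorseCube.bracket o (w n) (x n) = 0 ∧ MorseCube.bracket o (w n) y = 0 ∧
        MorseCube.bracket o (w n) z = 0 ∧ MorseCube.bracket o (x n) z = 0 ∧
        MorseCube.bracket o y z = 0 ∧
        MorseCube.gromovProd o (w n) (x n) = n ∧ MorseCube.gromovProd o (w n) y = 0 ∧
        MorseCube.gromovProd o (w n) z = 0 ∧ MorseCube.gromovProd o (x n) z = 0 ∧
        MorseCube.gromovProd o y z = 2 ∧
        MorseCube.cr o (w n) (x n) y z = 0 ∧
        MorseCube.bfm o (w n) (x n) y z = n + 2 ∧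
        ∀ m : ℕ,
          MorseCube.bracket (o * (MorseCube.c⁻¹) ^ m) (w n) (x n) = 0 ∧
          MorseCube.bracket (o * (MorseCube.c⁻¹) ^ m) y z = m ∧
          MorseCube.bracket (o * (MorseCube.c⁻¹) ^ m) (w n) y = 0 ∧
          MorseCube.bracket (o * (MorseCube.c⁻¹) ^ m) (x n) z = 0 ∧
          MorseCube.cr (o * (MorseCube.c⁻¹) ^ m) (w n) (x n) y z = m)) ∧
    -- the difference of the two cross ratios is unbounded
    (∀ (o : MorseCube.G) (R : ℤ), ∃ w x y z : MorseCube.Bdry, [w, x, y, z].Pairwise (· ≠ ·) ∧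
      R < |MorseCube.cr o w x y z - MorseCube.bfm o w x y z|) ∧
    -- the cross ratio depends on the base point
    (∀ o : MorseCube.G, ∃ (o' : MorseCube.G) (w x y z : MorseCube.Bdry),
      [w, x, y, z].Pairwise (· ≠ ·) ∧
      MorseCube.cr o w x y z ≠ MorseCube.cr o' w x y z) := by
  have hword : ∀ (o : MorseCube.G) (l : List MorseCube.G) (x y z : ℤ),
      l.prod = MorseCube.a ^ x * MorseCube.b ^ y * MorseCube.c ^ z →
      MorseCube.Represents o (MorseCube.eventually l MorseCube.d)
        (MorseCube.boundaryPoint (o * MorseCube.lattice false ![x, y, z, 0])) := by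
    intro o l x y z hl
    rw [MorseCube.lattice_vec, ← hl]
    exact MorseCube.represents_boundaryPoint o l
  refine ⟨MorseCube.boundaryDist_eq_expNeg_bracket, fun o => ⟨_, _, _, _,
    fun n => hword o _ n 0 0 (by simp), fun n => hword o _ n 1 0 (by simp),
    hword o _ (-1) (-1) 0 (by simp), hword o _ (-1) (-1) 1 (by simp [mul_assoc]),
    fun n => MorseCube.four_points o n _ _ _ _ rfl rfl rfl rfl⟩, fun o R => ?_, fun o => ?_⟩
  · obtain ⟨hne, -, -, -, -, -, -, -, -, -, -, hcr, hbfm, -⟩ :=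
      MorseCube.four_points o R.toNat _ _ _ _ rfl rfl rfl rfl
    refine ⟨_, _, _, _, hne, ?_⟩
    rw [hcr, hbfm, zero_sub, abs_neg]
    exact lt_of_lt_of_le (by omega) (le_abs_self _)
  · obtain ⟨hne, -, -, -, -, -, -, -, -, -, -, hcr, -, hm⟩ :=
      MorseCube.four_points o 0 _ _ _ _ rfl rfl rfl rfl
    refine ⟨o * MorseCube.c⁻¹ ^ 1, _, _, _, _, hne, ?_⟩
    rw [hcr, (hm 1).2.2.2.2]
    norm_num
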